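/- Let $d\in\{2,3\}$, $T>0$, let $D\subset\mathbb R^d$ be open and bounded, and let $\Omega_0$ be open with $\overline{\Omega_0}\subset D$ and $C^2$ boundary. Let $\mathrm w\in C^1([0,T];C^k_c(D;\mathbb R^d))$ for some integer $k\ge 2$, with compact support in $D$ uniform in time, and $\operatorname{div}\mathrm w=0$. Let $\Phi:[0,T]\times D\to D$ be its flow, $\partial_t\Phi(t,x)=\mathrm w(t,\Phi(t,x))$, $\Phi(0,x)=x$; write $\Phi_t=\Phi(t,\cdot)$ and $\Omega(t)=\Phi_t(\Omega_0)$. For a domain $\Omega$ let $V(\Omega)=\{u\in H^1_0(\Omega;\mathbb R^d):\operatorname{div}u=0\}$ and let $V^*(\Omega)$ be the space of all $f\in H^{-1}(\Omega;\mathbb R^d)=H^1_0(\Omega;\mathbb R^d)^*$ that are weakly divergence free, i.e. $\langle f,\nabla q\rangle=0$ for all $q\in C^1_0(\Omega)$ ($C^1$ with compact support in $\Omega$) with $\nabla q\in H^1_0(\Omega;\mathbb R^d)$; it carries the norm of $H^{-1}$. Write $V(t)=V(\Omega(t))$, $V_0=V(\Omega_0)$, $V^*(t)=V^*(\Omega(t))$,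 $V_0^*=V^*(\Omega_0)$. Let $\phi_tu=(D\Phi_t\,u)\circ\Phi_t^{-1}$ be the Piola transform, with inverse $\phi_{-t}u=D\Phi_t^{-1}(u\circ\Phi_t)$. For $f\in H^{-1}(\Omega(t);\mathbb R^d)$ define $\phi_{-t}f\in H^{-1}(\Omega_0;\mathbb R^d)$ by $\langle\phi_{-t}f,v\rangle=\langle f,(D\Phi_t^{-T}v)\circ\Phi_t^{-1}\rangle$ for $v\in H^1_0(\Omega_0;\mathbb R^d)$. Let $L^2_V$, $L^2_{H^{-1}}$, $L^2_{V^*}$ be the spaces of functions $t\mapsto f(t)$ with $f(t)$ in $V(t)$, $H^{-1}(\Omega(t);\mathbb R^d)$, $V^*(t)$ respectively for a.e. $t\in(0,T)$, such that $\phi_{-(\cdot)}f(\cdot)$ belongs to $L^2(0,T;V_0)$, $L^2(0,T;H^{-1}(\Omega_0;\mathbb R^d))$, $L^2(0,T;V_0^*)$ respectively. Let $u\in L^2_V$ have a weak material derivative $g=\partial^\bullet_\phi u$, that is, $g\in L^2_{H^{-1}}$ and $$\int_0^T\langle g(t),\eta(t)\rangle\,dt=-\int_0^T\big(u(t),\phi_t\tfrac{d}{dt}(\phi_{-t}\eta(t))\big)_{L^2(\Omega(t))}dt-\int_0^T\lambda(t;u(t),\eta(t))\,dt$$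 for all $\eta$ with $\eta(t)\in H^1_0(\Omega(t);\mathbb R^d)$ and $\phi_{-(\cdot)}\eta(\cdot)\in C^1_0(0,T;H^1_0(\Omega_0;\mathbb R^d))$ ($C^1$ with compact support in $(0,T)$), where $$\lambda(t;u,v)=\int_{\Omega(t)}u\cdot\Big(D\Phi_t^{-T}\tfrac{d}{dt}\big(D\Phi_t^TD\Phi_t\big)D\Phi_t^{-1}\Big)\circ\Phi_t^{-1}\,v .$$ Then $g\in L^2_{V^*}$: for a.e. $t$ the functional $\partial^\bullet_\phi u(t)$ is weakly divergence free, and $\phi_{-(\cdot)}\partial^\bullet_\phi u(\cdot)\in L^2(0,T;V_0^*)$. -/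

import Mathlib

open MeasureTheory Set Topology
open scoped ContDiff InnerProductSpace Distributions

noncomputable section

namespace MovingStokes

/-- Euclidean space `ℝ^d`. -/
abbrev E (d : ℕ) : Type := EuclideanSpace ℝ (Fin d)

/-- `d × d` matrices with the Frobenius inner product; the `i`-th entry stands for the vector
`∂_i u`. -/
abbrev Mat (d : ℕ) : Type := PiLp 2 (fun _ : Fin d => E d)

variable {d : ℕ}

/-! ### The data: velocity field, flow, moving domain -/

/-- The bounded open set `Ω` has `C²` boundary: near every boundary point it is the sublevel
set `{ρ < 0}` of a `C²` function with nonvanishing differential at that point. -/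
def HasC2Boundary (Ω : Set (E d)) : Prop :=
  ∀ x₀ ∈ frontier Ω, ∃ U : Set (E d), IsOpen U ∧ x₀ ∈ U ∧ ∃ ρ : E d → ℝ,
    ContDiff ℝ 2 ρ ∧ fderiv ℝ ρ x₀ ≠ 0 ∧ Ω ∩ U = {x ∈ U | ρ x < 0}

/-- `w ∈ C¹([0,T]; C^k_c(D; ℝ^d))` for some `k ≥ 2`, with a compact support in space that does
not depend on time, and `div w = 0` on `[0,T] × D`. The curve and its derivative take values in
the space of `C^k` fields supported in the compact set `K ⊆ D`, with its `C^k` topology. -/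
def IsVelocityField (D : Set (E d)) (T : ℝ) (w : ℝ → E d → E d) : Prop :=
  (∃ k : ℕ, 2 ≤ k ∧ ∃ K : TopologicalSpace.Compacts (E d), (K : Set (E d)) ⊆ D ∧
    ∃ W W' : ℝ → 𝓓^{(k : ℕ∞)}_{K}(E d, E d),
      (∀ t ∈ Icc 0 T, HasDerivWithinAt W (W' t) (Icc 0 T) t) ∧
      ContinuousOn W' (Icc 0 T) ∧
      ∀ t ∈ Icc 0 T, ∀ x ∈ D, w t x = W t x) ∧
  ∀ t ∈ Icc 0 T, ∀ x ∈ D, ∑ i, fderiv ℝ (w t) x (EuclideanSpace.single i 1) i = 0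

/-- `Φ : [0,T] × D → D` is the flow of `w`: `Φ_0 = Id` and `∂_t Φ(t,x) = w(t, Φ(t,x))`.
The values of `Φ` outside `[0,T] × D` play no role. -/
def IsFlow (D : Set (E d)) (T : ℝ) (w : ℝ → E d → E d) (Φ : ℝ → E d → E d) : Prop :=
  (∀ x ∈ D, Φ 0 x = x) ∧
  ∀ t ∈ Icc 0 T, ∀ x ∈ D, Φ t x ∈ D ∧
    HasDerivWithinAt (fun s => Φ s x) (w t (Φ t x)) (Icc 0 T) t

/-- The moving domain `Ω(t) = Φ_t(Ω₀)`. -/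
def movingDomain (Φ : ℝ → E d → E d) (Ω₀ : Set (E d)) (t : ℝ) : Set (E d) := Φ t '' Ω₀

/-- The inverse `Φ_t⁻¹ : Ω(t) → Ω₀`. -/
def flowInv (Φ : ℝ → E d → E d) (Ω₀ : Set (E d)) (t : ℝ) : E d → E d :=
  Function.invFunOn (Φ t) Ω₀

/-! ### The spaces `H^1_0`, `H^{-1}`, `V`, `V^*` on a domain -/

/-- `L²(Ω; ℝ^d) × L²(Ω; ℝ^{d×d})` with its Hilbert space structure. -/
abbrev L2Pair (Ω : Set (E d)) : Type :=
  WithLp 2 (Lp (E d) 2 (volume.restrict Ω) × Lp (Mat d) 2 (volume.restrict Ω))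

/-- The gradient matrix `(∂_i φ)_i` of a differentiable vector field. -/
def gradMat (φ : E d → E d) (x : E d) : Mat d :=
  WithLp.toLp 2 (fun i => fderiv ℝ φ x (EuclideanSpace.single i 1))

/-- `H^1_0(Ω; ℝ^d)`: the closure of `{(φ, Dφ) : φ ∈ C_c^∞(Ω; ℝ^d)}` in
`L²(Ω; ℝ^d) × L²(Ω; ℝ^{d×d})`, that is, the closure of the test fields for the inner product
`∫_Ω Du : Dv + u · v`, an element being recorded together with its weak gradient. -/
def H10 (Ω : Set (E d)) : Submodule ℝ (L2Pair Ω) :=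
  (Submodule.span ℝ {p : L2Pair Ω | ∃ φ : E d → E d,
    ContDiff ℝ ∞ φ ∧ HasCompactSupport φ ∧ tsupport φ ⊆ Ω ∧
    p.fst =ᵐ[volume.restrict Ω] φ ∧ p.snd =ᵐ[volume.restrict Ω] gradMat φ}).topologicalClosure

/-- The (class of the) function underlying an element of `H^1_0(Ω; ℝ^d)`. -/
def H10.fn {Ω : Set (E d)} (v : H10 Ω) : Lp (E d) 2 (volume.restrict Ω) := (v : L2Pair Ω).fst

/-- The weak gradient of an element of `H^1_0(Ω; ℝ^d)`. -/
def H10.grad {Ω : Set (E d)} (v : H10 Ω) : Lp (Mat d) 2 (volume.restrict Ω) :=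
  (v : L2Pair Ω).snd

/-- `H^{-1}(Ω; ℝ^d)`, the dual of `H^1_0(Ω; ℝ^d)`, with the dual norm. -/
abbrev Hneg1 (Ω : Set (E d)) : Type := StrongDual ℝ (H10 Ω)

/-- `V(Ω) = {u ∈ H^1_0(Ω; ℝ^d) : div u = 0}`. -/
def V (Ω : Set (E d)) : Submodule ℝ (H10 Ω) where
  carrier := {v | ∀ᵐ x ∂(volume.restrict Ω), ∑ i, (H10.grad v x i) i = 0}
  zero_mem' := by
    have h : H10.grad (0 : H10 Ω) = 0 := rfl
    simp only [mem_ofPred_eq, h]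
    filter_upwards [Lp.coeFn_zero (Mat d) 2 (volume.restrict Ω)] with x hx
    rw [hx]
    simp
  add_mem' := by
    intro a b ha hb
    have h : H10.grad (a + b) = H10.grad a + H10.grad b := rfl
    simp only [mem_ofPred_eq, h] at ha hb ⊢
    filter_upwards [Lp.coeFn_add (H10.grad a) (H10.grad b), ha, hb] with x hx h1 h2
    rw [hx]
    simp [Finset.sum_add_distrib, h1, h2]
  smul_mem' := by
    intro c a ha
    have h : H10.grad (c • a) = c • H10.grad a := rfl
    simp only [mem_ofPred_eq, h] at ha ⊢
    filter_upwards [Lp.coeFn_smul c (H10.grad a), ha] with x hx h1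
    rw [hx]
    simp [← Finset.mul_sum, h1]

/-- `p ∈ H^1_0(Ω; ℝ^d)` is the gradient `∇q` of some `q ∈ C_0^1(Ω; ℝ)`. -/
def IsTestGradient {Ω : Set (E d)} (p : H10 Ω) : Prop :=
  ∃ q : E d → ℝ, ContDiff ℝ 1 q ∧ HasCompactSupport q ∧ tsupport q ⊆ Ω ∧
    H10.fn p =ᵐ[volume.restrict Ω] gradient q

/-- `V^*(Ω) = {f ∈ H^{-1}(Ω; ℝ^d) : div f = 0 weakly}`, where weakly divergence free means
`⟨f, ∇q⟩ = 0` for all `q ∈ C_0^1(Ω; ℝ)` with `∇q ∈ H^1_0(Ω; ℝ^d)`. -/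
def Vstar (Ω : Set (E d)) : Submodule ℝ (Hneg1 Ω) where
  carrier := {f | ∀ p : H10 Ω, IsTestGradient p → f p = 0}
  zero_mem' := by intro p _; rfl
  add_mem' := by
    intro a b ha hb p hp
    simp [ha p hp, hb p hp]
  smul_mem' := by
    intro c a ha p hp
    simp [ha p hp]

/-! ### The Piola transform -/

section Piola

variable (Φ : ℝ → E d → E d) (Ω₀ : Set (E d)) (t : ℝ)

/-- The Piola transform `φ_t u = (DΦ_t u) ∘ Φ_t⁻¹`. -/
def piola (u : E d → E d) : E d → E d := fun y =>
  fderiv ℝ (Φ t) (flowInv Φ Ω₀ t y) (u (flowInv Φ Ω₀ t y))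

/-- The inverse Piola transform `φ_{-t} u = DΦ_t⁻¹ (u ∘ Φ_t)`. -/
def piolaInv (u : E d → E d) : E d → E d := fun x =>
  (fderiv ℝ (Φ t) x).inverse (u (Φ t x))

/-- The covariant Piola transform `φ_t^* u = DΦ_tᵀ (u ∘ Φ_t)`, whose inverse is
`φ_{-t}^* v = (DΦ_t⁻ᵀ v) ∘ Φ_t⁻¹`. -/
def piolaStar (u : E d → E d) : E d → E d := fun x =>
  ContinuousLinearMap.adjoint (fderiv ℝ (Φ t) x) (u (Φ t x))

variable {Φ Ω₀ t}

/-- `v₀ = φ_{-t} v` for `v ∈ H^1_0(Ω(t); ℝ^d)` and `v₀ ∈ H^1_0(Ω₀; ℝ^d)`. -/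
def IsPullback (v : H10 (movingDomain Φ Ω₀ t)) (v₀ : H10 Ω₀) : Prop :=
  H10.fn v₀ =ᵐ[volume.restrict Ω₀] piolaInv Φ t (H10.fn v)

/-- `f₀ = φ_{-t} f` for `f ∈ H^{-1}(Ω(t); ℝ^d)` and `f₀ ∈ H^{-1}(Ω₀; ℝ^d)`:
`⟨f₀, v₀⟩ = ⟨f, φ_{-t}^* v₀⟩` for all `v₀`, where `v = φ_{-t}^* v₀` is
expressed as `v₀ = φ_t^* v`. -/
def IsDualPullback (f : Hneg1 (movingDomain Φ Ω₀ t)) (f₀ : Hneg1 Ω₀) : Prop :=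
  ∀ (v₀ : H10 Ω₀) (v : H10 (movingDomain Φ Ω₀ t)),
    H10.fn v₀ =ᵐ[volume.restrict Ω₀] piolaStar Φ t (H10.fn v) → f₀ v₀ = f v

end Piola

/-! ### Time-dependent Bochner spaces and the weak material derivative -/

section Bochner

variable {Φ : ℝ → E d → E d} {Ω₀ : Set (E d)}

/-- `u ∈ L²_V`: `u(t) ∈ V(t)` for a.e. `t`, and `φ_{-(·)} u(·) ∈ L²(0,T; V₀)`. -/
def MemL2V (T : ℝ) (u : (t : ℝ) → H10 (movingDomain Φ Ω₀ t)) : Prop :=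
  (∀ᵐ t ∂(volume.restrict (Ioo 0 T)), u t ∈ V (movingDomain Φ Ω₀ t)) ∧
  ∃ u₀ : ℝ → V Ω₀, MemLp u₀ 2 (volume.restrict (Ioo 0 T)) ∧
    ∀ᵐ t ∂(volume.restrict (Ioo 0 T)), IsPullback (u t) (u₀ t : H10 Ω₀)

/-- `g ∈ L²_{H^{-1}}`: `φ_{-(·)} g(·) ∈ L²(0,T; H^{-1}(Ω₀; ℝ^d))`. -/
def MemL2Hneg1 (T : ℝ) (g : (t : ℝ) → Hneg1 (movingDomain Φ Ω₀ t)) : Prop :=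
  ∃ g₀ : ℝ → Hneg1 Ω₀, MemLp g₀ 2 (volume.restrict (Ioo 0 T)) ∧
    ∀ᵐ t ∂(volume.restrict (Ioo 0 T)), IsDualPullback (g t) (g₀ t)

/-- `g ∈ L²_{V^*}`: `g(t) ∈ V^*(t)` for a.e. `t`, and `φ_{-(·)} g(·) ∈ L²(0,T; V₀^*)`. -/
def MemL2Vstar (T : ℝ) (g : (t : ℝ) → Hneg1 (movingDomain Φ Ω₀ t)) : Prop :=
  (∀ᵐ t ∂(volume.restrict (Ioo 0 T)), g t ∈ Vstar (movingDomain Φ Ω₀ t)) ∧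
  ∃ g₀ : ℝ → Vstar Ω₀, MemLp g₀ 2 (volume.restrict (Ioo 0 T)) ∧
    ∀ᵐ t ∂(volume.restrict (Ioo 0 T)), IsDualPullback (g t) (g₀ t : Hneg1 Ω₀)

/-- `η ∈ D(0,T)` with pullback `η₀ = φ_{-(·)} η(·) ∈ C_0^1(0,T; H^1_0(Ω₀; ℝ^d))`. -/
structure IsTestFunction (T : ℝ) (η : (t : ℝ) → H10 (movingDomain Φ Ω₀ t))
    (η₀ : ℝ → H10 Ω₀) : Prop where
  contDiff : ContDiff ℝ 1 η₀
  hasCompactSupport : HasCompactSupport η₀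
  tsupport_subset : tsupport η₀ ⊆ Ioo 0 T
  isPullback : ∀ t ∈ Ioo 0 T, IsPullback (η t) (η₀ t)

variable (Φ Ω₀) in
/-- The strong material derivative `φ_t (d/dt (φ_{-t} η(t)))` of the function `η` with pullback
`η₀ = φ_{-(·)} η(·)`. -/
def strongMaterialDeriv (η₀ : ℝ → H10 Ω₀) (t : ℝ) : E d → E d :=
  piola Φ Ω₀ t (H10.fn (deriv η₀ t))

variable (Φ) in
/-- `DΦ_t⁻ᵀ (d/dt (DΦ_tᵀ DΦ_t)) DΦ_t⁻¹` at the point `x`. -/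
def lambdaMat (t : ℝ) (x : E d) : E d →L[ℝ] E d :=
  (ContinuousLinearMap.adjoint (fderiv ℝ (Φ t) x)).inverse ∘L
    deriv (fun s => ContinuousLinearMap.adjoint (fderiv ℝ (Φ s) x) ∘L fderiv ℝ (Φ s) x) t ∘L
      (fderiv ℝ (Φ t) x).inverse

variable (Φ Ω₀) in
/-- The bilinear form `λ(t; u, v)`, equal to
`∫_{Ω(t)} u · ((DΦ_t⁻ᵀ (d/dt (DΦ_tᵀ DΦ_t)) DΦ_t⁻¹) ∘ Φ_t⁻¹) v`. -/
def lambdaForm (t : ℝ) (u v : E d → E d) : ℝ :=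
  ∫ y in movingDomain Φ Ω₀ t, ⟪u y, lambdaMat Φ t (flowInv Φ Ω₀ t y) (v y)⟫_ℝ

/-- `g ∈ L²_{H^{-1}}` is the weak material derivative of `u`:
`∫_0^T ⟨g, η⟩ = - ∫_0^T (u, ∂^• η)_{L²(Ω(t))} - ∫_0^T λ(t; u, η)` for all `η ∈ D(0,T)`. -/
def IsWeakMaterialDeriv (T : ℝ) (u : (t : ℝ) → H10 (movingDomain Φ Ω₀ t))
    (g : (t : ℝ) → Hneg1 (movingDomain Φ Ω₀ t)) : Prop :=
  MemL2Hneg1 T g ∧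
  ∀ (η : (t : ℝ) → H10 (movingDomain Φ Ω₀ t)) (η₀ : ℝ → H10 Ω₀), IsTestFunction T η η₀ →
    ∫ t in Ioo 0 T, g t (η t) =
      - (∫ t in Ioo 0 T, ∫ y in movingDomain Φ Ω₀ t,
          ⟪H10.fn (u t) y, strongMaterialDeriv Φ Ω₀ η₀ t y⟫_ℝ)
      - ∫ t in Ioo 0 T, lambdaForm Φ Ω₀ t (H10.fn (u t)) (H10.fn (η t))

end Bochner

end MovingStokes

end

/-! Everything follows from one test field. For a scalar function `q` with compact support in `Ω₀`
and a scalar cutoff `ψ` with compact support in `(0,T)`, put `η(t) = ψ(t) ∇(q ∘ Φ_t⁻¹) = ψ(t)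
(DΦ_t⁻ᵀ ∇q) ∘ Φ_t⁻¹`. By definition of the dual pullback, the left side of the weak identity is `∫ ψ
⟨g₀, ∇q⟩` with `g₀ = φ_{-t} g`. The Piola pullback of `η` is `ψ M⁻¹ ∇q` with `M = DΦ_tᵀ DΦ_t`. Since
`d/dt M⁻¹ = -M⁻¹ M' M⁻¹`, the strong material derivative of `η` is `ψ' ∇(q ∘ Φ_t⁻¹)` minus exactly
the matrix of `λ` applied to `η`. The `λ` terms cancel, and what remains pairs `u(t)` with a
gradient, which gives zero because `u(t)` is divergence free and vanishes on the boundary in the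
`H^1_0` sense. This is `IsPathFlow.integral_smul_eq_zero`, resting on
`IsPathFlow.exists_pullback_gradient`.

Since `ψ` is arbitrary, `⟨g₀(t), ∇q⟩ = 0` for a.e. `t`. Separability of `H^1_0(Ω₀)` makes the null
set independent of `q` (`ae_forall_mem_apply_eq_zero`). Mollification passes from smooth `q` to `C¹`
functions whose gradient lies in `H^1_0` (`mem_Vstar_of_forall_smooth`). Composing test functions
with `Φ_t` carries the conclusion from `g₀(t)` to `g(t)` (`IsDualPullback.mem_Vstar`).

The technical burden is to show that `η` is admissible, that is, `ψ M⁻¹ ∇q` is a `C¹` curve in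
`H^1_0(Ω₀)`. To handle time and space together, the flow is viewed as a map `γ` from points to
continuous paths on `[0,T]`. It solves `γ(x) = x + ∫ f(s, γ(x)(s)) ds`, and the inverse function
theorem in path space makes it `C²` in `x` (`contDiffOn_solution`). The linearised equation is of
Volterra type, hence invertible for every `T`. Jacobians, metrics and their inverses are then `C¹`
functions with values in a Banach algebra of paths. -/

noncomputable section

namespace MovingStokes

open Filter ContinuousLinearMap
open scoped Convolution ENNReal

/-! ### Mollification in `L²`. -/

section Mollification

variable {d : ℕ} {F : Type*} [NormedAddCommGroup F]

/-- Translation is continuous in `L²` at the origin. -/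
theorem exists_eLpNorm_translate_sub_le {f : E d → F} (hf : MemLp f 2 volume) {ε : ℝ≥0∞}
    (hε : 0 < ε) :
    ∃ δ > 0, ∀ y : E d, ‖y‖ < δ → eLpNorm (fun x => f (x - y) - f x) 2 volume ≤ ε := by
  let τ : E d → C(E d, E d) := fun y => ⟨fun x => x - y, by fun_prop⟩
  have hτm : ∀ y, MeasurePreserving (τ y) volume volume := fun y =>
    measurePreserving_sub_right volume y
  have hτ : Continuous τ := by
    apply ContinuousMap.continuous_of_continuous_uncurry
    simp only [Function.uncurry_def, τ, ContinuousMap.coe_mk]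
    fun_prop
  have hc : Continuous fun y => Lp.compMeasurePreserving (τ y) (hτm y) (hf.toLp f) :=
    continuous_const.compMeasurePreservingLp hτ hτm (by norm_num)
  have h0 : Lp.compMeasurePreserving (τ 0) (hτm 0) (hf.toLp f) = hf.toLp f := by
    rw [Lp.toLp_compMeasurePreserving]
    congr 1
    ext x
    simp [τ]
  have ht := hc.tendsto 0
  rw [h0, Metric.tendsto_nhds_nhds] at ht
  have key : ∀ y, eLpNorm (fun x => f (x - y) - f x) 2 volume =
      edist (Lp.compMeasurePreserving (τ y) (hτm y) (hf.toLp f)) (hf.toLp f) := by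
    intro y
    rw [Lp.toLp_compMeasurePreserving, Lp.edist_toLp_toLp]
    rfl
  -- `ε` may be `⊤`, so a positive real number below it is needed for the metric statement.
  obtain ⟨ε', hε', hε'ε⟩ : ∃ r : ℝ, 0 < r ∧ ENNReal.ofReal r ≤ ε := by
    rcases eq_or_ne ε ⊤ with rfl | h
    · exact ⟨1, one_pos, le_top⟩
    · exact ⟨ε.toReal, ENNReal.toReal_pos hε.ne' h, (ENNReal.ofReal_toReal h).le⟩
  obtain ⟨δ, hδ, H⟩ := ht ε' hε'
  refine ⟨δ, hδ, fun y hy => ?_⟩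
  rw [key, edist_dist]
  exact (ENNReal.ofReal_le_ofReal (H (by simpa using hy)).le).trans hε'ε

/-- The `L²` distance of a function to its mollification is controlled by that to its
translates. -/
theorem eLpNorm_convolution_sub_le [NormedSpace ℝ F] [CompleteSpace F] {f : E d → F} (hfm : StronglyMeasurable f)
    (hf : MemLp f 2 volume) (φ : ContDiffBump (0 : E d)) {ε : ℝ≥0∞}
    (h : ∀ y : E d, ‖y‖ < φ.rOut → eLpNorm (fun x => f (x - y) - f x) 2 volume ≤ ε) :
    eLpNorm (fun x => (φ.normed volume ⋆[lsmul ℝ ℝ, volume] f) x - f x) 2 volume ≤ ε := by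
  set ρ := φ.normed (volume : Measure (E d)) with hρ
  have hρc : Continuous ρ := φ.continuous_normed
  have hρ0 : ∀ y, 0 ≤ ρ y := φ.nonneg_normed
  have hρi : ∫ y, ρ y = 1 := φ.integral_normed
  have hρint : Integrable ρ := φ.integrable_normed
  -- The mollifier is a probability density. Jensen's inequality for `ν` (as monotonicity of `L^p`
  -- norms) bounds the pointwise error by an average of translation errors; Tonelli then gives the
  -- `L²` bound.
  set ν : Measure (E d) := volume.withDensity (fun y => ENNReal.ofReal (ρ y)) with hν
  have hν1 : IsProbabilityMeasure ν := by
    constructor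
    rw [hν, withDensity_apply _ MeasurableSet.univ, Measure.restrict_univ,
      ← ofReal_integral_eq_lintegral_ofReal hρint (.of_forall hρ0), hρi, ENNReal.ofReal_one]
  have hm2 : StronglyMeasurable fun p : E d × E d => f (p.1 - p.2) - f p.1 :=
    (hfm.comp_measurable (measurable_fst.sub measurable_snd)).sub
      (hfm.comp_measurable measurable_fst)
  have hloc : LocallyIntegrable f volume := hf.locallyIntegrable (by norm_num)
  have hpt : ∀ x, ‖(ρ ⋆[lsmul ℝ ℝ, volume] f) x - f x‖ₑ ^ 2 ≤
      ∫⁻ y, ‖f (x - y) - f x‖ₑ ^ 2 ∂ν := by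
    intro x
    have e1 : (ρ ⋆[lsmul ℝ ℝ, volume] f) x - f x = ∫ y, ρ y • (f (x - y) - f x) := by
      have hi : Integrable (fun y => ρ y • f (x - y)) :=
        (φ.hasCompactSupport_normed.convolutionExists_left (lsmul ℝ ℝ) hρc hloc x).integrable
      simp_rw [smul_sub]
      rw [integral_sub hi (hρint.smul_const _), integral_smul_const, hρi, one_smul]
      rfl
    have e2 : ‖(ρ ⋆[lsmul ℝ ℝ, volume] f) x - f x‖ₑ ≤ ∫⁻ y, ‖f (x - y) - f x‖ₑ ∂ν := by
      rw [e1, hν, lintegral_withDensity_eq_lintegral_mul _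
        (by fun_prop) (by
          exact (hm2.comp_measurable (measurable_prodMk_left (x := x))).enorm)]
      refine (enorm_integral_le_lintegral_enorm _).trans (le_of_eq ?_)
      congr 1
      ext y
      simp [enorm_smul, Real.enorm_eq_ofReal (hρ0 y)]
    have hmx : AEStronglyMeasurable (fun y => f (x - y) - f x) ν :=
      (hm2.comp_measurable (measurable_prodMk_left (x := x))).aestronglyMeasurable
    have e3 := eLpNorm_le_eLpNorm_of_exponent_le (p := 1) (q := 2) (by norm_num) hmx
    rw [eLpNorm_one_eq_lintegral_enorm] at e3
    have e4 := (e2.trans e3)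
    calc _ ≤ (eLpNorm (fun y => f (x - y) - f x) 2 ν) ^ 2 := by gcongr
      _ = _ := by
        rw [eLpNorm_eq_lintegral_rpow_enorm_toReal (by norm_num) (by norm_num)]
        simp only [ENNReal.toReal_ofNat, ENNReal.rpow_ofNat]
        rw [← ENNReal.rpow_natCast, ← ENNReal.rpow_mul]
        simp
  have hsq : ∀ g : E d → F, eLpNorm g 2 volume ^ 2 = ∫⁻ x, ‖g x‖ₑ ^ 2 := by
    intro g
    rw [eLpNorm_eq_lintegral_rpow_enorm_toReal (by norm_num) (by norm_num)]
    simp only [ENNReal.toReal_ofNat, ENNReal.rpow_ofNat]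
    rw [← ENNReal.rpow_natCast, ← ENNReal.rpow_mul]
    simp
  rw [← ENNReal.pow_le_pow_left_iff (two_ne_zero), hsq]
  calc _ ≤ ∫⁻ x, ∫⁻ y, ‖f (x - y) - f x‖ₑ ^ 2 ∂ν := lintegral_mono hpt
    _ = ∫⁻ y, (∫⁻ x, ‖f (x - y) - f x‖ₑ ^ 2) ∂ν := by
        exact lintegral_lintegral_swap (hm2.enorm.pow_const 2).aemeasurable
    _ = ∫⁻ y, eLpNorm (fun x => f (x - y) - f x) 2 volume ^ 2 ∂ν := by simp_rw [hsq]
    _ ≤ ∫⁻ y, ε ^ 2 ∂ν := by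
        apply lintegral_mono_ae
        rw [hν, ae_withDensity_iff (by fun_prop)]
        refine .of_forall fun y hy => ?_
        gcongr
        apply h
        -- Only points of positive density matter, and these lie in the ball of radius `rOut`.
        have : y ∈ Function.support ρ := by
          intro h0
          simp [h0] at hy
        rw [hρ, φ.support_normed_eq] at this
        simpa using this
    _ = ε ^ 2 := by simp

/-- Mollifications converge in `L²`. -/
theorem tendsto_eLpNorm_convolution_sub [NormedSpace ℝ F] [CompleteSpace F] {f : E d → F}
    (hfm : StronglyMeasurable f) (hf : MemLp f 2 volume) {φ : ℕ → ContDiffBump (0 : E d)}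
    (hφ : Tendsto (fun n => (φ n).rOut) atTop (𝓝 0)) :
    Tendsto (fun n => eLpNorm (fun x =>
      ((φ n).normed volume ⋆[lsmul ℝ ℝ, volume] f) x - f x) 2 volume) atTop (𝓝 0) := by
  rw [ENNReal.tendsto_nhds_zero]
  intro ε hε
  obtain ⟨δ, hδ, H⟩ := exists_eLpNorm_translate_sub_le hf hε
  filter_upwards [hφ.eventually_lt_const hδ] with n hn
  exact eLpNorm_convolution_sub_le hfm hf (φ n) fun y hy => H y (hy.trans hn)

end Mollification

end MovingStokes

namespace MovingStokes

open Filter ContinuousLinearMap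
open scoped Convolution ENNReal

/-! ### Weak gradients and integration by parts. -/

section WeakGradient

variable {d : ℕ} {Ω : Set (E d)}

/-- The standard basis vectors of `ℝ^d`. -/
abbrev stdVec (i : Fin d) : E d := EuclideanSpace.single i 1

/-- The divergence `∑ i, ∂_i Θ_i` of a matrix field. -/
def divMat (Θ : E d → Mat d) (x : E d) : E d := ∑ i, fderiv ℝ Θ x (stdVec i) i

/-- The element of `L²(Ω; ℝ^d) × L²(Ω; ℝ^{d×d})` given by a pair of square integrable functions. -/
def pairOf {a : E d → E d} {B : E d → Mat d} (ha : MemLp a 2 (volume.restrict Ω))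
    (hB : MemLp B 2 (volume.restrict Ω)) : L2Pair Ω :=
  WithLp.toLp 2 (ha.toLp a, hB.toLp B)

theorem inner_pairOf {a : E d → E d} {B : E d → Mat d} (ha : MemLp a 2 (volume.restrict Ω))
    (hB : MemLp B 2 (volume.restrict Ω)) (p : L2Pair Ω) :
    ⟪pairOf ha hB, p⟫_ℝ = ∫ x in Ω, ⟪a x, p.fst x⟫_ℝ + ⟪B x, p.snd x⟫_ℝ := by
  rw [WithLp.prod_inner_apply, L2.inner_def, L2.inner_def, ← integral_add]
  · apply integral_congr_ae
    filter_upwards [ha.coeFn_toLp, hB.coeFn_toLp] with x h1 h2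
    simp only [pairOf]
    rw [h1, h2]
    rfl
  · exact L2.integrable_inner _ _
  · exact L2.integrable_inner _ _

/-- `B` is the weak gradient of `a` on the whole space. -/
def HasWeakGrad (a : E d → E d) (B : E d → Mat d) : Prop :=
  ∀ Θ : E d → Mat d, ContDiff ℝ ∞ Θ → HasCompactSupport Θ →
    ∫ x, ⟪divMat Θ x, a x⟫_ℝ + ⟪Θ x, B x⟫_ℝ = 0

theorem continuous_divMat {Θ : E d → Mat d} (hΘ : ContDiff ℝ 1 Θ) : Continuous (divMat Θ) := by
  unfold divMat
  have := hΘ.continuous_fderiv one_ne_zero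
  fun_prop

theorem HasCompactSupport.divMat {Θ : E d → Mat d} (hΘ : HasCompactSupport Θ) :
    HasCompactSupport (divMat Θ) := by
  refine (hΘ.fderiv (𝕜 := ℝ)).mono fun x hx => ?_
  contrapose! hx
  simp only [Function.mem_support, not_not] at hx ⊢
  simp [MovingStokes.divMat, hx]

theorem continuous_gradMat {φ : E d → E d} (hφ : ContDiff ℝ 1 φ) : Continuous (gradMat φ) := by
  unfold gradMat
  have := hφ.continuous_fderiv one_ne_zero
  fun_prop

theorem support_gradMat_subset (φ : E d → E d) : Function.support (gradMat φ) ⊆ tsupport φ := by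
  refine Subset.trans (fun x hx => ?_) (support_fderiv_subset ℝ (f := φ))
  contrapose! hx
  simp only [Function.mem_support, not_not] at hx ⊢
  simp only [gradMat, hx]
  rfl

theorem HasCompactSupport.gradMat {φ : E d → E d} (hφ : HasCompactSupport φ) :
    HasCompactSupport (gradMat φ) :=
  HasCompactSupport.of_support_subset_isCompact hφ (support_gradMat_subset φ)

theorem fderiv_smul_const_apply {F : Type*} [NormedAddCommGroup F] [NormedSpace ℝ F] {q : E d → ℝ}
    {x : E d} (hq : DifferentiableAt ℝ q x) (c : F) (v : E d) :
    fderiv ℝ (fun x => q x • c) x v = fderiv ℝ q x v • c := by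
  rw [(hq.hasFDerivAt.smul_const c).fderiv]
  rfl

theorem gradient_apply (q : E d → ℝ) (x : E d) (j : Fin d) :
    gradient q x j = fderiv ℝ q x (stdVec j) := by
  have h2 : ⟪gradient q x, stdVec j⟫_ℝ = fderiv ℝ q x (stdVec j) := by
    rw [gradient, InnerProductSpace.toDual_symm_apply]
  rw [← h2, EuclideanSpace.inner_single_right]
  simp

/-- Integration by parts for `C¹` fields. -/
theorem integral_divMat_inner_add {Θ : E d → Mat d} {φ : E d → E d} (hΘ : ContDiff ℝ 1 Θ)
    (hφ : ContDiff ℝ 1 φ) (hφc : HasCompactSupport φ) :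
    ∫ x, ⟪divMat Θ x, φ x⟫_ℝ + ⟪Θ x, gradMat φ x⟫_ℝ = 0 := by
  have hΘ' := hΘ.continuous_fderiv one_ne_zero
  have hφ' := hφ.continuous_fderiv one_ne_zero
  have i1 : ∀ i, Integrable fun x => ⟪fderiv ℝ Θ x (stdVec i) i, φ x⟫_ℝ := fun i =>
    Continuous.integrable_of_hasCompactSupport (by fun_prop)
      (hφc.mono fun x hx => by
        contrapose! hx
        simp only [Function.mem_support, not_not] at hx ⊢
        simp [hx])
  have i2 : ∀ i, Integrable fun x => ⟪Θ x i, fderiv ℝ φ x (stdVec i)⟫_ℝ := fun i =>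
    Continuous.integrable_of_hasCompactSupport (by fun_prop)
      ((hφc.fderiv (𝕜 := ℝ)).mono fun x hx => by
        contrapose! hx
        simp only [Function.mem_support, not_not] at hx ⊢
        simp [hx])
  have i3 : ∀ i, Integrable fun x => ⟪Θ x i, φ x⟫_ℝ := fun i =>
    Continuous.integrable_of_hasCompactSupport (by fun_prop)
      (hφc.mono fun x hx => by
        contrapose! hx
        simp only [Function.mem_support, not_not] at hx ⊢
        simp [hx])
  have e : ∀ x, ⟪divMat Θ x, φ x⟫_ℝ + ⟪Θ x, gradMat φ x⟫_ℝ =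
      ∑ i, (⟪fderiv ℝ Θ x (stdVec i) i, φ x⟫_ℝ + ⟪Θ x i, fderiv ℝ φ x (stdVec i)⟫_ℝ) := by
    intro x
    rw [Finset.sum_add_distrib, divMat, sum_inner, PiLp.inner_apply]
    rfl
  simp_rw [e]
  rw [integral_finsetSum (f := fun i x => ⟪fderiv ℝ Θ x (stdVec i) i, φ x⟫_ℝ +
    ⟪Θ x i, fderiv ℝ φ x (stdVec i)⟫_ℝ) _ fun i _ => (i1 i).add (i2 i)]
  refine Finset.sum_eq_zero fun i _ => ?_
  rw [integral_add (i1 i) (i2 i)]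
  have hd : ∀ x, HasFDerivAt (fun x => Θ x i)
      ((PiLp.proj 2 (fun _ : Fin d => E d) i : Mat d →L[ℝ] E d) ∘L fderiv ℝ Θ x) x := fun x =>
    (PiLp.proj 2 (fun _ : Fin d => E d) i : Mat d →L[ℝ] E d).hasFDerivAt.comp x
      (hΘ.differentiable one_ne_zero x).hasFDerivAt
  have := integral_bilinear_hasFDerivAt_right_eq_neg_left_of_integrable (μ := volume)
    (B := innerSL ℝ) (v := stdVec i) (f := fun x => Θ x i) (g := φ)
    (f' := fun x => (PiLp.proj 2 (fun _ : Fin d => E d) i : Mat d →L[ℝ] E d) ∘L fderiv ℝ Θ x)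
    (g' := fderiv ℝ φ) (i1 i) (i2 i) (i3 i) (fun x _ => hd x)
    (fun x _ => (hφ.differentiable one_ne_zero x).hasFDerivAt)
  change ∫ x, ⟪Θ x i, fderiv ℝ φ x (stdVec i)⟫_ℝ =
    -∫ x, ⟪fderiv ℝ Θ x (stdVec i) i, φ x⟫_ℝ at this
  rw [this, add_neg_cancel]

/-- Elements of `H^1_0(Ω)` satisfy the integration by parts formula. -/
theorem H10.integral_divMat_inner_add (v : H10 Ω) {Θ : E d → Mat d} (hΘ : ContDiff ℝ 1 Θ)
    (hΘc : HasCompactSupport Θ) :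
    ∫ x in Ω, ⟪divMat Θ x, H10.fn v x⟫_ℝ + ⟪Θ x, H10.grad v x⟫_ℝ = 0 := by
  have h1 : MemLp (divMat Θ) 2 (volume.restrict Ω) :=
    ((continuous_divMat hΘ).memLp_of_hasCompactSupport (HasCompactSupport.divMat hΘc)).restrict _
  have h2 : MemLp Θ 2 (volume.restrict Ω) :=
    (hΘ.continuous.memLp_of_hasCompactSupport hΘc).restrict _
  change ∫ x in Ω, ⟪divMat Θ x, (v : L2Pair Ω).fst x⟫_ℝ + ⟪Θ x, (v : L2Pair Ω).snd x⟫_ℝ = 0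
  rw [← inner_pairOf h1 h2]
  -- The identity says that `v` is orthogonal to `(div Θ, Θ)`. Orthogonality is a closed condition,
  -- so it need only be checked on test fields.
  have hle : H10 Ω ≤ (ℝ ∙ pairOf h1 h2)ᗮ := by
    apply Submodule.topologicalClosure_minimal _ _ (Submodule.isClosed_orthogonal _)
    rw [Submodule.span_le]
    rintro p ⟨φ, hφ, hφc, hφs, hp1, hp2⟩
    rw [SetLike.mem_coe, Submodule.mem_orthogonal_singleton_iff_inner_right, inner_pairOf]
    have : ∫ x in Ω, ⟪divMat Θ x, p.fst x⟫_ℝ + ⟪Θ x, p.snd x⟫_ℝ =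
        ∫ x in Ω, ⟪divMat Θ x, φ x⟫_ℝ + ⟪Θ x, gradMat φ x⟫_ℝ := by
      apply integral_congr_ae
      filter_upwards [hp1, hp2] with x hx1 hx2
      rw [hx1, hx2]
    rw [this, setIntegral_eq_integral_of_forall_compl_eq_zero]
    · exact MovingStokes.integral_divMat_inner_add hΘ (hφ.of_le (by simp)) hφc
    · intro x hx
      have hx' : x ∉ tsupport φ := fun h => hx (hφs h)
      rw [image_eq_zero_of_notMem_tsupport hx',
        Function.notMem_support.mp fun h => hx' (support_gradMat_subset φ h)]
      simp
  exact Submodule.mem_orthogonal_singleton_iff_inner_right.mp (hle v.2)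

/-- Divergence free elements of `H^1_0(Ω)` are orthogonal to gradients. -/
theorem integral_inner_gradient_eq_zero {v : H10 Ω} (hv : v ∈ V Ω) {q : E d → ℝ}
    (hq : ContDiff ℝ 1 q) (hqc : HasCompactSupport q) :
    ∫ x in Ω, ⟪H10.fn v x, gradient q x⟫_ℝ = 0 := by
  -- For `Θ = q I` one has `div Θ = ∇q`, while `Θ : Dv = q div v` vanishes.
  let I : Mat d := WithLp.toLp 2 fun i => stdVec i
  have h := H10.integral_divMat_inner_add v (Θ := fun x => q x • I) (hq.smul contDiff_const)
    hqc.smul_right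
  rw [← h]
  apply integral_congr_ae
  have hv' : ∀ᵐ x ∂(volume.restrict Ω), ∑ i, (H10.grad v x i) i = 0 := hv
  filter_upwards [hv'] with x hx
  have hd := (hq.differentiable one_ne_zero x)
  have e1 : divMat (fun x => q x • I) x = gradient q x := by
    unfold divMat
    ext j
    simp only [fderiv_smul_const_apply hd]
    rw [gradient_apply]
    simp [I, Pi.single_apply]
  have e2 : ⟪q x • I, H10.grad v x⟫_ℝ = 0 := by
    rw [inner_smul_left, PiLp.inner_apply]
    simp only [I, stdVec, EuclideanSpace.inner_single_left]
    simp [hx]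
  rw [e1, e2, add_zero, real_inner_comm]

end WeakGradient

end MovingStokes

namespace MovingStokes

open Filter ContinuousLinearMap
open scoped Convolution ENNReal

/-! ### Density of smooth fields in `H^1_0` and of smooth test gradients. -/

section Density

variable {d : ℕ} {Ω : Set (E d)}

theorem fderiv_convolution_apply {a : E d → E d} (ha : LocallyIntegrable a volume) {ρ : E d → ℝ}
    (hρ : ContDiff ℝ 1 ρ) (hρc : HasCompactSupport ρ) (x v : E d) :
    fderiv ℝ (ρ ⋆[lsmul ℝ ℝ, volume] a) x v = ∫ t, fderiv ℝ ρ (x - t) v • a t := by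
  rw [(hρc.hasFDerivAt_convolution_left (lsmul ℝ ℝ) hρ ha x).fderiv, convolution_def,
    ContinuousLinearMap.integral_apply
      ((hρc.fderiv (𝕜 := ℝ)).convolutionExists_left ((lsmul ℝ ℝ).precompL (E d))
        (hρ.continuous_fderiv one_ne_zero) ha x).integrable,
    ← integral_sub_left_eq_self _ volume x]
  simp [precompL_apply]

/-- Apply the weak identity to `Θ(t) = ρ(x - t) C` with an arbitrary constant matrix `C`. The
reflection in `x - t` produces the sign that turns integration by parts into the equality. -/
theorem gradMat_convolution {a : E d → E d} {B : E d → Mat d} (ha : LocallyIntegrable a volume)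
    (hB : LocallyIntegrable B volume) (h : HasWeakGrad a B) {ρ : E d → ℝ}
    (hρ : ContDiff ℝ ∞ ρ) (hρc : HasCompactSupport ρ) (x : E d) :
    gradMat (ρ ⋆[lsmul ℝ ℝ, volume] a) x = (ρ ⋆[lsmul ℝ ℝ, volume] B) x := by
  have hρ1 : ContDiff ℝ 1 ρ := hρ.of_le (by simp)
  have hτ : IsProperMap fun t : E d => x - t := (Homeomorph.subLeft x).isProperMap
  have hs : HasCompactSupport fun t => ρ (x - t) := hρc.comp_homeomorph (Homeomorph.subLeft x)
  have hs' : HasCompactSupport fun t => fderiv ℝ ρ (x - t) :=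
    (hρc.fderiv (𝕜 := ℝ)).comp_homeomorph (Homeomorph.subLeft x)
  have hc : ContDiff ℝ ∞ fun t => ρ (x - t) := hρ.comp (contDiff_const.sub contDiff_id)
  have hc' : Continuous fun t => fderiv ℝ ρ (x - t) :=
    (hρ1.continuous_fderiv one_ne_zero).comp (continuous_const.sub continuous_id)
  have i1 : ∀ i, Integrable fun t => fderiv ℝ ρ (x - t) (stdVec i) • a t := fun i =>
    ha.integrable_smul_left_of_hasCompactSupport (by fun_prop)
      (hs'.mono fun t ht => by
        contrapose! ht
        simp only [Function.mem_support, not_not] at ht ⊢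
        simp [ht])
  have i2 : Integrable fun t => ρ (x - t) • B t :=
    hB.integrable_smul_left_of_hasCompactSupport hc.continuous hs
  refine ext_inner_left ℝ fun C => ?_
  have hΘ := h (fun t => ρ (x - t) • C) (hc.smul contDiff_const) hs.smul_right
  have hd : ∀ t v, fderiv ℝ (fun t => ρ (x - t)) t v = -fderiv ℝ ρ (x - t) v := by
    intro t v
    have h1 : HasFDerivAt (fun t => ρ (x - t)) ((fderiv ℝ ρ (x - t)).comp (-.id ℝ (E d))) t :=
      ((hρ1.differentiable one_ne_zero) (x - t)).hasFDerivAt.comp t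
        ((hasFDerivAt_id t).const_sub x)
    rw [h1.fderiv]
    simp
  have e1 : ∀ t, ⟪divMat (fun t => ρ (x - t) • C) t, a t⟫_ℝ + ⟪ρ (x - t) • C, B t⟫_ℝ =
      ⟪C, ρ (x - t) • B t⟫_ℝ - ∑ i, ⟪C i, fderiv ℝ ρ (x - t) (stdVec i) • a t⟫_ℝ := by
    intro t
    have e2 : divMat (fun t => ρ (x - t) • C) t =
        ∑ i, (-fderiv ℝ ρ (x - t) (stdVec i)) • C i := by
      unfold divMat
      refine Finset.sum_congr rfl fun i _ => ?_
      rw [fderiv_smul_const_apply (hc.differentiable (by simp) t), hd]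
      rfl
    rw [e2, sum_inner, inner_smul_left, inner_smul_right]
    simp only [inner_smul_left, inner_smul_right, map_neg, neg_mul, Finset.sum_neg_distrib]
    simp
    ring
  simp_rw [e1] at hΘ
  rw [integral_sub (i2.const_inner C) (integrable_finsetSum _ fun i _ => (i1 i).const_inner (C i)),
    integral_finsetSum _ (fun i _ => (i1 i).const_inner (C i)), integral_inner i2] at hΘ
  have e3 : ⟪C, gradMat (ρ ⋆[lsmul ℝ ℝ, volume] a) x⟫_ℝ =
      ∑ i, ∫ t, ⟪C i, fderiv ℝ ρ (x - t) (stdVec i) • a t⟫_ℝ := by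
    rw [PiLp.inner_apply]
    refine Finset.sum_congr rfl fun i _ => ?_
    rw [integral_inner (i1 i), ← fderiv_convolution_apply ha hρ1 hρc]
    rfl
  rw [e3, ← sub_eq_zero.mp hΘ, convolution_def, ← integral_sub_left_eq_self _ volume x]
  simp

/-- The derivative falls on `q`, so continuity of `ρ` suffices. It shows that mollifying a gradient
field again gives a gradient field. -/
theorem gradient_convolution {q : E d → ℝ} (hq : ContDiff ℝ 1 q) (hqc : HasCompactSupport q)
    {ρ : E d → ℝ} (hρ : Continuous ρ) (x : E d) :
    gradient (ρ ⋆[lsmul ℝ ℝ, volume] q) x = (ρ ⋆[lsmul ℝ ℝ, volume] gradient q) x := by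
  have hg : Continuous (gradient q) :=
    (InnerProductSpace.toDual ℝ (E d)).symm.continuous.comp (hq.continuous_fderiv one_ne_zero)
  have hgc : HasCompactSupport (gradient q) := (hqc.fderiv (𝕜 := ℝ)).mono fun x hx => by
    contrapose! hx
    simp only [Function.mem_support, not_not] at hx ⊢
    simp [gradient, hx]
  ext j
  rw [gradient_apply,
    (hqc.hasFDerivAt_convolution_right (lsmul ℝ ℝ) hρ.locallyIntegrable hq x).fderiv,
    convolution_def, convolution_def, ContinuousLinearMap.integral_apply
      ((hqc.fderiv (𝕜 := ℝ)).convolutionExists_right ((lsmul ℝ ℝ).precompR (E d))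
        hρ.locallyIntegrable (hq.continuous_fderiv one_ne_zero) x).integrable]
  have := (EuclideanSpace.proj j : E d →L[ℝ] ℝ).integral_comp_comm
    (hgc.convolutionExists_right (lsmul ℝ ℝ) (hρ.locallyIntegrable (μ := volume)) hg x).integrable
  refine Eq.trans ?_ this
  simp [precompR_apply, gradient_apply]

/-- A field with compact support in `Ω` and square integrable weak gradient is the limit in
`H^1` of its mollifications, which are test fields. -/
theorem exists_seq_mollification (hΩ : IsOpen Ω) {K : Set (E d)} (hK : IsCompact K) (hKΩ : K ⊆ Ω)
    {a : E d → E d} {B : E d → Mat d} (ham : StronglyMeasurable a) (hBm : StronglyMeasurable B)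
    (ha : MemLp a 2 volume) (hB : MemLp B 2 volume) (haK : Function.support a ⊆ K)
    (hw : HasWeakGrad a B) :
    ∃ φ : ℕ → ContDiffBump (0 : E d), (∀ n, Metric.cthickening (φ n).rOut K ⊆ Ω) ∧
      ∃ p : ℕ → H10 Ω,
        (∀ n, H10.fn (p n) =ᵐ[volume.restrict Ω] (φ n).normed volume ⋆[lsmul ℝ ℝ, volume] a) ∧
        Tendsto (fun n => (p n : L2Pair Ω)) atTop (𝓝 (pairOf (ha.restrict Ω) (hB.restrict Ω))) := by
  obtain ⟨δ, hδ, hδΩ⟩ := hK.exists_cthickening_subset_open hΩ hKΩ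
  -- The radii tend to zero and never exceed `δ`, so all mollifications are supported in a fixed
  -- thickening of `K` inside `Ω`.
  let φ : ℕ → ContDiffBump (0 : E d) := fun n =>
    ⟨δ / (n + 1) / 2, δ / (n + 1), by positivity, half_lt_self (by positivity)⟩
  have hφle : ∀ n, (φ n).rOut ≤ δ := fun n =>
    div_le_self hδ.le (by simp)
  have hφ0 : Tendsto (fun n => (φ n).rOut) atTop (𝓝 0) := by
    have := (tendsto_one_div_add_atTop_nhds_zero_nat (𝕜 := ℝ)).const_mul δ
    simpa [φ, div_eq_mul_inv] using this
  have hφK : ∀ n, Metric.cthickening (φ n).rOut K ⊆ Ω := fun n =>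
    (Metric.cthickening_mono (hφle n) K).trans hδΩ
  have hla := ha.locallyIntegrable (by norm_num : (1 : ℝ≥0∞) ≤ 2)
  have hlB := hB.locallyIntegrable (by norm_num : (1 : ℝ≥0∞) ≤ 2)
  let A : ℕ → E d → E d := fun n => (φ n).normed volume ⋆[lsmul ℝ ℝ, volume] a
  have hρ : ∀ n, ContDiff ℝ ∞ ((φ n).normed (volume : Measure (E d))) :=
    fun n => (φ n).contDiff_normed
  have hρc : ∀ n, HasCompactSupport ((φ n).normed (volume : Measure (E d))) :=
    fun n => (φ n).hasCompactSupport_normed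
  have hA : ∀ n, ContDiff ℝ ∞ (A n) := fun n =>
    (hρc n).contDiff_convolution_left _ (hρ n) hla
  have hAs : ∀ n, Function.support (A n) ⊆ Metric.cthickening (φ n).rOut K := by
    intro n x hx
    obtain ⟨y, hy, z, hz, rfl⟩ := (support_convolution_subset _) hx
    rw [(φ n).support_normed_eq] at hy
    apply Metric.mem_cthickening_of_dist_le _ z _ _ (haK hz)
    simpa using (mem_ball_zero_iff.mp hy).le
  have hAt : ∀ n, tsupport (A n) ⊆ Ω := fun n =>
    (closure_minimal (hAs n) Metric.isClosed_cthickening).trans (hφK n)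
  have hAc : ∀ n, HasCompactSupport (A n) := fun n =>
    HasCompactSupport.of_support_subset_isCompact hK.cthickening (hAs n)
  have hG : ∀ n, gradMat (A n) = (φ n).normed volume ⋆[lsmul ℝ ℝ, volume] B := fun n =>
    funext fun x => gradMat_convolution hla hlB hw (hρ n) (hρc n) x
  have hAm : ∀ n, MemLp (A n) 2 volume := fun n =>
    (hA n).continuous.memLp_of_hasCompactSupport (hAc n)
  have hGm : ∀ n, MemLp (gradMat (A n)) 2 volume := fun n =>
    (continuous_gradMat ((hA n).of_le (by simp))).memLp_of_hasCompactSupport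
      (HasCompactSupport.gradMat (hAc n))
  have hmem : ∀ n, pairOf ((hAm n).restrict Ω) ((hGm n).restrict Ω) ∈ H10 Ω := fun n =>
    Submodule.le_topologicalClosure _ (Submodule.subset_span
      ⟨A n, hA n, hAc n, hAt n, ((hAm n).restrict Ω).coeFn_toLp, ((hGm n).restrict Ω).coeFn_toLp⟩)
  refine ⟨φ, hφK, fun n => ⟨pairOf ((hAm n).restrict Ω) ((hGm n).restrict Ω), hmem n⟩,
    fun n => ((hAm n).restrict Ω).coeFn_toLp, ?_⟩
  have t1 : Tendsto (fun n => ((hAm n).restrict Ω).toLp (A n)) atTop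
      (𝓝 ((ha.restrict Ω).toLp a)) := by
    rw [Lp.tendsto_Lp_iff_tendsto_eLpNorm'']
    refine tendsto_of_tendsto_of_tendsto_of_le_of_le tendsto_const_nhds
      (tendsto_eLpNorm_convolution_sub ham ha hφ0) (fun _ => zero_le) fun n => ?_
    exact eLpNorm_mono_measure _ Measure.restrict_le_self
  have t2 : Tendsto (fun n => ((hGm n).restrict Ω).toLp (gradMat (A n))) atTop
      (𝓝 ((hB.restrict Ω).toLp B)) := by
    rw [Lp.tendsto_Lp_iff_tendsto_eLpNorm'']
    refine tendsto_of_tendsto_of_tendsto_of_le_of_le tendsto_const_nhds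
      (tendsto_eLpNorm_convolution_sub hBm hB hφ0) (fun _ => zero_le) fun n => ?_
    rw [hG]
    exact eLpNorm_mono_measure _ Measure.restrict_le_self
  exact ((WithLp.prod_continuous_toLp 2 _ _).tendsto _).comp (t1.prodMk_nhds t2)

/-- `C¹` fields with compact support in `Ω` belong to `H^1_0(Ω)`. -/
theorem pairOf_mem_H10 (hΩ : IsOpen Ω) {φ : E d → E d} (hφ : ContDiff ℝ 1 φ)
    (hφc : HasCompactSupport φ) (hφΩ : tsupport φ ⊆ Ω) (h1 : MemLp φ 2 (volume.restrict Ω))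
    (h2 : MemLp (gradMat φ) 2 (volume.restrict Ω)) : pairOf h1 h2 ∈ H10 Ω := by
  have hg := continuous_gradMat hφ
  obtain ⟨-, -, p, -, hp⟩ := exists_seq_mollification hΩ hφc hφΩ hφ.continuous.stronglyMeasurable
    hg.stronglyMeasurable (hφ.continuous.memLp_of_hasCompactSupport hφc)
    (hg.memLp_of_hasCompactSupport (HasCompactSupport.gradMat hφc)) (subset_tsupport _)
    (fun Θ hΘ _ => integral_divMat_inner_add (hΘ.of_le (by simp)) hφ hφc)
  exact (Submodule.isClosed_topologicalClosure _).mem_of_tendsto hp (.of_forall fun n => (p n).2)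

theorem exists_H10_of_contDiff (hΩ : IsOpen Ω) {φ : E d → E d} (hφ : ContDiff ℝ 1 φ)
    (hφc : HasCompactSupport φ) (hφΩ : tsupport φ ⊆ Ω) :
    ∃ v : H10 Ω, H10.fn v =ᵐ[volume.restrict Ω] φ :=
  have h1 := (hφ.continuous.memLp_of_hasCompactSupport (μ := volume) (p := 2) hφc).restrict Ω
  ⟨⟨_, pairOf_mem_H10 hΩ hφ hφc hφΩ h1 (((continuous_gradMat hφ).memLp_of_hasCompactSupport
      (HasCompactSupport.gradMat hφc)).restrict _)⟩, h1.coeFn_toLp⟩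

/-- A functional that vanishes on gradients of smooth functions with compact support in `Ω` is
weakly divergence free. -/
theorem mem_Vstar_of_forall_smooth (hΩ : IsOpen Ω) {f : Hneg1 Ω}
    (hf : ∀ (q : E d → ℝ) (p : H10 Ω), ContDiff ℝ ∞ q → HasCompactSupport q → tsupport q ⊆ Ω →
      H10.fn p =ᵐ[volume.restrict Ω] gradient q → f p = 0) : f ∈ Vstar Ω := by
  rintro p ⟨q, hq, hqc, hqΩ, hpq⟩
  have hgc : Continuous (gradient q) :=
    (InnerProductSpace.toDual ℝ (E d)).symm.continuous.comp (hq.continuous_fderiv one_ne_zero)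
  have hgs : Function.support (gradient q) ⊆ tsupport q := by
    refine Subset.trans (fun x hx => ?_) (support_fderiv_subset ℝ (f := q))
    contrapose! hx
    simp only [Function.mem_support, not_not] at hx ⊢
    simp [gradient, hx]
  have hgcs : HasCompactSupport (gradient q) :=
    HasCompactSupport.of_support_subset_isCompact hqc hgs
  set B : E d → Mat d := Ω.indicator (H10.grad p) with hBdef
  have hBm : StronglyMeasurable B := (Lp.stronglyMeasurable _).indicator hΩ.measurableSet
  have hB : MemLp B 2 volume := (memLp_indicator_iff_restrict hΩ.measurableSet).2 (Lp.memLp _)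
  have ha : MemLp (gradient q) 2 volume := hgc.memLp_of_hasCompactSupport hgcs
  -- Since `q` is only `C¹`, its second derivatives exist only through `p ∈ H^1_0(Ω)`. Extended by
  -- zero, the gradient recorded in `p` is a weak gradient of `∇q` on the whole space.
  have hw : HasWeakGrad (gradient q) B := by
    intro Θ hΘ hΘc
    rw [← H10.integral_divMat_inner_add p (hΘ.of_le (by simp)) hΘc,
      ← setIntegral_eq_integral_of_forall_compl_eq_zero (s := Ω)]
    · apply integral_congr_ae
      filter_upwards [hpq, ae_restrict_mem hΩ.measurableSet] with x hx hxΩ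
      rw [hx, hBdef, indicator_of_mem hxΩ]
    · intro x hx
      rw [hBdef, indicator_of_notMem hx, Function.notMem_support.mp fun h => hx (hqΩ (hgs h))]
      simp
  obtain ⟨φ, hφ, P, hP, hlim⟩ := exists_seq_mollification hΩ hqc hqΩ hgc.stronglyMeasurable hBm ha
    hB hgs hw
  have hpe : pairOf (ha.restrict Ω) (hB.restrict Ω) = (p : L2Pair Ω) := by
    apply WithLp.ofLp_injective
    refine Prod.ext ?_ ?_
    · apply Lp.ext
      exact (ha.restrict Ω).coeFn_toLp.trans hpq.symm
    · apply Lp.ext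
      refine (hB.restrict Ω).coeFn_toLp.trans ?_
      filter_upwards [ae_restrict_mem hΩ.measurableSet] with x hxΩ
      rw [hBdef, indicator_of_mem hxΩ]
      rfl
  rw [hpe] at hlim
  have hlim' : Tendsto P atTop (𝓝 p) := tendsto_subtype_rng.2 hlim
  have h0 : ∀ n, f (P n) = 0 := by
    intro n
    have hs : Function.support ((φ n).normed volume ⋆[lsmul ℝ ℝ, volume] q) ⊆
        Metric.cthickening (φ n).rOut (tsupport q) := by
      intro x hx
      obtain ⟨y, hy, z, hz, rfl⟩ := (support_convolution_subset _) hx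
      rw [(φ n).support_normed_eq] at hy
      apply Metric.mem_cthickening_of_dist_le _ z _ _ (subset_tsupport _ hz)
      simpa using (mem_ball_zero_iff.mp hy).le
    -- The mollification of `∇q` is the gradient of the mollification of `q`, which is an admissible
    -- smooth test function.
    refine hf ((φ n).normed volume ⋆[lsmul ℝ ℝ, volume] q) (P n) ?_ ?_ ?_ ?_
    · exact (φ n).hasCompactSupport_normed.contDiff_convolution_left _ (φ n).contDiff_normed
        hq.continuous.locallyIntegrable
    · exact HasCompactSupport.of_support_subset_isCompact hqc.isCompact.cthickening hs
    · exact (closure_minimal hs Metric.isClosed_cthickening).trans (hφ n)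
    · refine (hP n).trans (.of_forall fun x => ?_)
      rw [gradient_convolution hq hqc (φ n).continuous_normed]
  refine tendsto_nhds_unique ((f.continuous.tendsto p).comp hlim') ?_
  simp only [Function.comp_def, h0]
  exact tendsto_const_nhds

end Density

end MovingStokes

namespace MovingStokes

open Filter ContinuousLinearMap
open scoped Convolution ENNReal BoundedContinuousFunction

theorem continuousSMul_of_normedSpace (G : Type*) [NormedAddCommGroup G] [NormedSpace ℝ G] :
    ContinuousSMul ℝ G := inferInstance

instance {d : ℕ} : ContinuousSMul ℝ (Mat d) := continuousSMul_of_normedSpace (Mat d)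

/-! ### `C¹` curves in `H^1_0` from time-dependent fields. -/

section Curves

variable {d : ℕ} {Ω : Set (E d)} {G : Type*} [NormedAddCommGroup G]

/-- The curve of bounded continuous functions given by a jointly continuous function with compact
support. -/
def bcfCurve {X : Type*} [TopologicalSpace X] (F : ℝ → X → G) (hF : Continuous (Function.uncurry F))
    (hFc : HasCompactSupport (Function.uncurry F)) (t : ℝ) : X →ᵇ G :=
  BoundedContinuousFunction.ofNormedAddCommGroup (F t) (by
      have : F t = Function.uncurry F ∘ fun x => (t, x) := rfl
      rw [this]
      fun_prop) (hFc.exists_bound_of_continuous hF).choose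
    fun x => (hFc.exists_bound_of_continuous hF).choose_spec (t, x)

theorem continuous_bcfCurve {F : ℝ → E d → G} (hF : Continuous (Function.uncurry F))
    (hFc : HasCompactSupport (Function.uncurry F)) : Continuous (bcfCurve F hF hFc) := by
  have hu := hFc.uniformContinuous_of_continuous hF
  rw [Metric.uniformContinuous_iff] at hu
  rw [Metric.continuous_iff]
  intro t ε hε
  obtain ⟨δ, hδ, H⟩ := hu (ε / 2) (half_pos hε)
  refine ⟨δ, hδ, fun s hs => lt_of_le_of_lt ?_ (half_lt_self hε)⟩
  rw [BoundedContinuousFunction.dist_le (half_pos hε).le]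
  intro x
  exact (H (a := (s, x)) (b := (t, x)) (by simpa [Prod.dist_eq] using hs)).le

/-- Pointwise differentiability is promoted to the sup norm by the fundamental theorem of calculus:
evaluation at each point shows that the curve is the primitive of a continuous curve of bounded
functions. -/
theorem hasDerivAt_bcfCurve [NormedSpace ℝ G] [CompleteSpace G] {F F' : ℝ → E d → G}
    (hF : Continuous (Function.uncurry F))
    (hFc : HasCompactSupport (Function.uncurry F)) (hF' : Continuous (Function.uncurry F'))
    (hFc' : HasCompactSupport (Function.uncurry F'))
    (hd : ∀ t x, HasDerivAt (fun s => F s x) (F' t x) t) (t : ℝ) :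
    HasDerivAt (bcfCurve F hF hFc) (bcfCurve F' hF' hFc' t) t := by
  have hc := continuous_bcfCurve hF' hFc'
  have e : bcfCurve F hF hFc = fun t => bcfCurve F hF hFc 0 + ∫ s in 0..t, bcfCurve F' hF' hFc' s := by
    funext t
    ext x
    have h1 := (BoundedContinuousFunction.evalCLM ℝ x :
      (E d →ᵇ G) →L[ℝ] G).intervalIntegral_comp_comm (hc.intervalIntegrable (μ := volume) 0 t)
    have h2 : ∫ s in (0 : ℝ)..t, F' s x = F t x - F 0 x :=
      intervalIntegral.integral_eq_sub_of_hasDerivAt (fun s _ => hd s x)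
        (Continuous.intervalIntegrable (hF'.comp (by fun_prop : Continuous fun s : ℝ => (s, x))) _ _)
    change F t x = F 0 x + (BoundedContinuousFunction.evalCLM ℝ x :
      (E d →ᵇ G) →L[ℝ] G) (∫ s in (0 : ℝ)..t, bcfCurve F' hF' hFc' s)
    rw [← h1]
    change F t x = F 0 x + ∫ s in (0 : ℝ)..t, F' s x
    rw [h2]
    abel
  rw [e]
  exact (intervalIntegral.integral_hasDerivAt_right (hc.intervalIntegrable _ _)
    (hc.stronglyMeasurableAtFilter _ _) hc.continuousAt).const_add _

theorem support_timeDeriv_subset [NormedSpace ℝ G] {F F' : ℝ → E d → G} {J : Set ℝ} (hJ : IsCompact J)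
    {K : Set (E d)} (hF : Function.support (Function.uncurry F) ⊆ J ×ˢ K)
    (hd : ∀ t x, HasDerivAt (fun s => F s x) (F' t x) t) :
    Function.support (Function.uncurry F') ⊆ J ×ˢ K := by
  rintro ⟨t, x⟩ h
  contrapose! h
  have hz : ∀ s y, (s, y) ∉ J ×ˢ K → F s y = 0 := fun s y hs =>
    Function.notMem_support.mp fun h' => hs (hF h')
  rw [Function.notMem_support]
  have h0 : (fun s => F s x) =ᶠ[𝓝 t] fun _ => 0 := by
    by_cases hx : x ∈ K
    · have ht : t ∉ J := fun ht => h ⟨ht, hx⟩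
      filter_upwards [hJ.isClosed.isOpen_compl.mem_nhds ht] with s hs
      exact hz s x fun h' => hs h'.1
    · exact .of_forall fun s => hz s x fun h' => hx h'.2
  exact ((hd t x).congr_of_eventuallyEq h0.symm).unique (hasDerivAt_const t 0)

/-- A family of `C¹` fields with support in a fixed compact subset of `Ω` that is continuously
differentiable in time together with its gradient is a `C¹` curve in `H^1_0(Ω)`. -/
theorem exists_H10_curve (hΩ : IsOpen Ω) [IsFiniteMeasure (volume.restrict Ω)]
    {F F' : ℝ → E d → E d} {B' : ℝ → E d → Mat d} {J : Set ℝ} (hJ : IsCompact J)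
    {K : Set (E d)} (hK : IsCompact K) (hKΩ : K ⊆ Ω)
    (hFs : Function.support (Function.uncurry F) ⊆ J ×ˢ K)
    (hF1 : ∀ t, ContDiff ℝ 1 (F t))
    (hF : Continuous (Function.uncurry F)) (hF' : Continuous (Function.uncurry F'))
    (hB : Continuous (Function.uncurry fun t => gradMat (F t)))
    (hB' : Continuous (Function.uncurry B'))
    (hd : ∀ t x, HasDerivAt (fun s => F s x) (F' t x) t)
    (hdB : ∀ t x, HasDerivAt (fun s => gradMat (F s) x) (B' t x) t) :
    ∃ η : ℝ → H10 Ω, ContDiff ℝ 1 η ∧ (∀ t, H10.fn (η t) =ᵐ[volume.restrict Ω] F t) ∧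
      (∀ t, H10.fn (deriv η t) =ᵐ[volume.restrict Ω] F' t) ∧ tsupport η ⊆ J := by
  have hJK := hJ.prod hK
  have hFt : ∀ t, Function.support (F t) ⊆ K := fun t x hx => (hFs (a := (t, x)) hx).2
  have hFts : ∀ t, tsupport (F t) ⊆ K := fun t => closure_minimal (hFt t) hK.isClosed
  have hBs : Function.support (Function.uncurry fun t => gradMat (F t)) ⊆ J ×ˢ K := by
    intro p hp
    have hx : p.2 ∈ Function.support (gradMat (F p.1)) := hp
    have hx' : p.2 ∈ tsupport (F p.1) := support_gradMat_subset (F p.1) hx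
    refine ⟨?_, hFts p.1 hx'⟩
    by_contra ht
    have : F p.1 = 0 :=
      funext fun y => Function.notMem_support.mp fun h' => ht (hFs (a := (p.1, y)) h').1
    simp [this, tsupport] at hx'
  have cF := HasCompactSupport.of_support_subset_isCompact hJK hFs
  have cB := HasCompactSupport.of_support_subset_isCompact hJK hBs
  have cF' := HasCompactSupport.of_support_subset_isCompact hJK (support_timeDeriv_subset hJ hFs hd)
  have cB' := HasCompactSupport.of_support_subset_isCompact hJK (support_timeDeriv_subset hJ hBs hdB)
  let L1 : (E d →ᵇ E d) →L[ℝ] Lp (E d) 2 (volume.restrict Ω) :=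
    BoundedContinuousFunction.toLp 2 (volume.restrict Ω) ℝ
  let L2 : (E d →ᵇ Mat d) →L[ℝ] Lp (Mat d) 2 (volume.restrict Ω) :=
    BoundedContinuousFunction.toLp 2 (volume.restrict Ω) ℝ
  let Λ : (Lp (E d) 2 (volume.restrict Ω) × Lp (Mat d) 2 (volume.restrict Ω)) ≃L[ℝ] L2Pair Ω :=
    (WithLp.prodContinuousLinearEquiv 2 ℝ _ _).symm
  let c : ℝ → L2Pair Ω := fun t => Λ (L1 (bcfCurve F hF cF t), L2 (bcfCurve _ hB cB t))
  let c' : ℝ → L2Pair Ω := fun t => Λ (L1 (bcfCurve F' hF' cF' t), L2 (bcfCurve B' hB' cB' t))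
  have hc' : Continuous c' := by
    have h1 := continuous_bcfCurve hF' cF'
    have h2 := continuous_bcfCurve hB' cB'
    exact Λ.continuous.comp ((L1.continuous.comp h1).prodMk (L2.continuous.comp h2))
  have hcd : ∀ t, HasDerivAt c (c' t) t := fun t =>
    Λ.hasFDerivAt.comp_hasDerivAt t
      ((L1.hasFDerivAt.comp_hasDerivAt t (hasDerivAt_bcfCurve hF cF hF' cF' hd t)).prodMk
        (L2.hasFDerivAt.comp_hasDerivAt t (hasDerivAt_bcfCurve hB cB hB' cB' hdB t)))
  have hc1 : ∀ t, (c t).fst =ᵐ[volume.restrict Ω] F t := fun t =>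
    BoundedContinuousFunction.coeFn_toLp (p := 2) (μ := volume.restrict Ω) (𝕜 := ℝ)
      (bcfCurve F hF cF t)
  have hc1' : ∀ t, (c' t).fst =ᵐ[volume.restrict Ω] F' t := fun t =>
    BoundedContinuousFunction.coeFn_toLp (p := 2) (μ := volume.restrict Ω) (𝕜 := ℝ)
      (bcfCurve F' hF' cF' t)
  have hc2 : ∀ t, (c t).snd =ᵐ[volume.restrict Ω] gradMat (F t) := fun t =>
    BoundedContinuousFunction.coeFn_toLp (p := 2) (μ := volume.restrict Ω) (𝕜 := ℝ)
      (bcfCurve _ hB cB t)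
  have hmem : ∀ t, c t ∈ H10 Ω := by
    intro t
    have hcs : HasCompactSupport (F t) := HasCompactSupport.of_support_subset_isCompact hK (hFt t)
    have m1 := ((hF1 t).continuous.memLp_of_hasCompactSupport (μ := volume) (p := 2) hcs).restrict Ω
    have m2 := ((continuous_gradMat (hF1 t)).memLp_of_hasCompactSupport (μ := volume) (p := 2)
      (HasCompactSupport.gradMat hcs)).restrict Ω
    have := pairOf_mem_H10 hΩ (hF1 t) hcs ((hFts t).trans hKΩ) m1 m2
    convert this using 1
    apply WithLp.ofLp_injective
    exact Prod.ext (Lp.ext ((hc1 t).trans m1.coeFn_toLp.symm))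
      (Lp.ext ((hc2 t).trans m2.coeFn_toLp.symm))
  have hclosed : IsClosed (H10 Ω : Set (L2Pair Ω)) := Submodule.isClosed_topologicalClosure _
  have : CompleteSpace (H10 Ω) := hclosed.completeSpace_coe
  -- Since `c` already takes values in `H10 Ω`, the projection changes nothing; being bounded and
  -- linear, it transfers differentiability to the subspace.
  let P : L2Pair Ω →L[ℝ] H10 Ω := (H10 Ω).orthogonalProjectionOnto
  have hηd : ∀ t, HasDerivAt (fun t => P (c t)) (P (c' t)) t := fun t =>
    P.hasFDerivAt.comp_hasDerivAt t (hcd t)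
  have hPc : ∀ t, (P (c t) : L2Pair Ω) = c t := fun t =>
    Submodule.starProjection_eq_self_iff.mpr (hmem t)
  -- The identity `P c = c` passes to derivatives, so `c'` lies in `H10 Ω` as well.
  have hPc' : ∀ t, (P (c' t) : L2Pair Ω) = c' t := fun t => by
    have h1 : HasDerivAt (fun t => (P (c t) : L2Pair Ω)) (P (c' t) : L2Pair Ω) t :=
      (H10 Ω).subtypeL.hasFDerivAt.comp_hasDerivAt t (hηd t)
    simp only [hPc] at h1
    exact h1.unique (hcd t)
  refine ⟨fun t => P (c t), ?_, fun t => ?_, fun t => ?_, ?_⟩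
  · rw [contDiff_one_iff_deriv]
    refine ⟨fun t => (hηd t).differentiableAt, ?_⟩
    rw [show deriv (fun t => P (c t)) = fun t => P (c' t) from funext fun t => (hηd t).deriv]
    exact P.continuous.comp hc'
  · rw [H10.fn, hPc]
    exact hc1 t
  · rw [(hηd t).deriv, H10.fn, hPc']
    exact hc1' t
  · refine closure_minimal (fun t ht => ?_) hJ.isClosed
    by_contra htJ
    apply ht
    have z1 : bcfCurve F hF cF t = 0 := by
      ext x : 1
      exact Function.notMem_support.mp fun h' => htJ (hFs (a := (t, x)) h').1
    have z2 : bcfCurve _ hB cB t = 0 := by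
      ext x : 1
      exact Function.notMem_support.mp fun h' => htJ (hBs (a := (t, x)) h').1
    have hz : c t = 0 := by
      change Λ (L1 (bcfCurve F hF cF t), L2 (bcfCurve _ hB cB t)) = 0
      rw [z1, z2, map_zero, map_zero]
      exact map_zero Λ
    change P (c t) = 0
    rw [hz, map_zero]

end Curves

end MovingStokes

namespace MovingStokes

open Filter

/-! ### Superposition operators on spaces of continuous functions. -/

section Nemytskii

variable {S X F : Type*} [TopologicalSpace S] [CompactSpace S]
  [NormedAddCommGroup X] [NormedAddCommGroup F]

/-- The superposition operator `γ ↦ f(·, γ(·))` on continuous functions. -/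
def nemytskii (f : S → X → F) (hf : Continuous (Function.uncurry f)) (γ : C(S, X)) : C(S, F) :=
  ⟨fun s => f s (γ s), by exact hf.comp (continuous_id.prodMk γ.continuous)⟩

@[simp]
theorem nemytskii_apply {f : S → X → F} (hf : Continuous (Function.uncurry f)) (γ : C(S, X))
    (s : S) : nemytskii f hf γ s = f s (γ s) := rfl

theorem continuous_nemytskii {f : S → X → F} (hf : Continuous (Function.uncurry f)) :
    Continuous (nemytskii f hf) := by
  have h : nemytskii f hf = fun γ => (⟨Function.uncurry f, hf⟩ : C(S × X, F)).comp
      ((ContinuousMap.id S).prodMk γ) := rfl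
  rw [h]
  refine (ContinuousMap.continuous_postcomp _).comp ?_
  apply ContinuousMap.continuous_of_continuous_uncurry
  exact continuous_snd.prodMk (continuous_eval.comp (continuous_fst.prodMk continuous_snd))

variable [NormedSpace ℝ X] [NormedSpace ℝ F]

variable (S X F) in
/-- Pointwise application of a continuous family of operators. -/
def applyCLM : C(S, X →L[ℝ] F) →L[ℝ] C(S, X) →L[ℝ] C(S, F) :=
  LinearMap.mkContinuous₂
    (LinearMap.mk₂ ℝ (fun (A : C(S, X →L[ℝ] F)) (h : C(S, X)) =>
        (⟨fun s => A s (h s), by fun_prop⟩ : C(S, F)))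
      (by intros; ext; simp) (by intros; ext; simp) (by intros; ext; simp) (by intros; ext; simp))
    1 fun A h => by
      rw [ContinuousMap.norm_le _ (by positivity), one_mul]
      intro s
      exact (A s).le_of_opNorm_le_of_le (A.norm_coe_le_norm s) (h.norm_coe_le_norm s)

@[simp]
theorem applyCLM_apply (A : C(S, X →L[ℝ] F)) (h : C(S, X)) (s : S) :
    applyCLM S X F A h s = A s (h s) := rfl

/-- The mean value inequality in each fibre, made uniform in `s` by the sup-norm continuity of the
superposition operator of `f'`. -/
theorem hasFDerivAt_nemytskii {f : S → X → F} {f' : S → X → X →L[ℝ] F}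
    (hf : Continuous (Function.uncurry f)) (hf' : Continuous (Function.uncurry f'))
    (hd : ∀ s x, HasFDerivAt (f s) (f' s x) x) (γ : C(S, X)) :
    HasFDerivAt (nemytskii f hf) (applyCLM S X F (nemytskii f' hf' γ)) γ := by
  rw [hasFDerivAt_iff_isLittleO, Asymptotics.isLittleO_iff]
  intro c hc
  have hcont := (continuous_nemytskii hf').tendsto γ
  rw [Metric.tendsto_nhds_nhds] at hcont
  obtain ⟨δ, hδ, H⟩ := hcont c hc
  filter_upwards [Metric.ball_mem_nhds γ hδ] with γ' hγ'
  rw [ContinuousMap.norm_le _ (by positivity)]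
  intro s
  have hb : ∀ y ∈ Metric.ball (γ s) δ, ‖f' s y - f' s (γ s)‖ ≤ c := by
    intro y hy
    -- Shifting `γ` by a constant path makes it pass through `y` at `s`, so continuity in the sup
    -- norm controls `f' s y`.
    have h1 : dist (γ + ContinuousMap.const S (y - γ s)) γ < δ := by
      rw [dist_eq_norm, add_sub_cancel_left]
      refine lt_of_le_of_lt ((ContinuousMap.norm_le _ (norm_nonneg (y - γ s))).2 fun _ => le_rfl) ?_
      rwa [← dist_eq_norm]
    have h2 := (ContinuousMap.dist_apply_le_dist (f := nemytskii f' hf' _) (g := nemytskii f' hf' γ) s).trans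
      (H h1).le
    rw [dist_eq_norm] at h2
    simpa using h2
  have hs' : γ' s ∈ Metric.ball (γ s) δ :=
    lt_of_le_of_lt (ContinuousMap.dist_apply_le_dist s) hγ'
  have := (convex_ball (γ s) δ).norm_image_sub_le_of_norm_hasFDerivWithin_le'
    (fun y _ => (hd s y).hasFDerivWithinAt) hb (Metric.mem_ball_self hδ) hs'
  refine this.trans ?_
  gcongr
  exact (γ' - γ).norm_coe_le_norm s

theorem contDiff_one_nemytskii {f : S → X → F} {f' : S → X → X →L[ℝ] F}
    (hf : Continuous (Function.uncurry f)) (hf' : Continuous (Function.uncurry f'))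
    (hd : ∀ s x, HasFDerivAt (f s) (f' s x) x) : ContDiff ℝ 1 (nemytskii f hf) := by
  rw [contDiff_one_iff_fderiv]
  refine ⟨fun γ => (hasFDerivAt_nemytskii hf hf' hd γ).differentiableAt, ?_⟩
  rw [funext fun γ => (hasFDerivAt_nemytskii hf hf' hd γ).fderiv]
  exact (applyCLM S X F).continuous.comp (continuous_nemytskii hf')

/-- The derivative is a bounded linear map composed with the superposition operator of `f'`, so the
first-order result applies to it again. -/
theorem contDiff_two_nemytskii {f : S → X → F} {f' : S → X → X →L[ℝ] F}
    {f'' : S → X → X →L[ℝ] X →L[ℝ] F}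
    (hf : Continuous (Function.uncurry f)) (hf' : Continuous (Function.uncurry f'))
    (hf'' : Continuous (Function.uncurry f''))
    (hd : ∀ s x, HasFDerivAt (f s) (f' s x) x) (hd' : ∀ s x, HasFDerivAt (f' s) (f'' s x) x) :
    ContDiff ℝ 2 (nemytskii f hf) := by
  rw [show (2 : ℕ∞ω) = 1 + 1 by norm_num, contDiff_succ_iff_fderiv]
  refine ⟨fun γ => (hasFDerivAt_nemytskii hf hf' hd γ).differentiableAt, by simp, ?_⟩
  rw [funext fun γ => (hasFDerivAt_nemytskii hf hf' hd γ).fderiv]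
  exact (applyCLM S X F).contDiff.comp (contDiff_one_nemytskii hf' hf'' hd')

end Nemytskii

/-! ### Paths on `[0,T]` and Volterra operators. -/

section Volterra

/-- Continuous functions on `[0,T]`. -/
abbrev Path (T : ℝ) (F : Type*) [TopologicalSpace F] : Type _ := C(Icc (0 : ℝ) T, F)

variable {T : ℝ} (hT : 0 ≤ T) {F : Type*} [NormedAddCommGroup F]

/-- The extension of a path to the real line by constants. -/
def Path.extend (γ : Path T F) (t : ℝ) : F := γ (projIcc 0 T hT t)

theorem Path.continuous_extend (γ : Path T F) : Continuous (γ.extend hT) :=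
  γ.continuous.comp continuous_projIcc

theorem Path.norm_extend_le (γ : Path T F) (t : ℝ) : ‖γ.extend hT t‖ ≤ ‖γ‖ :=
  γ.norm_coe_le_norm _

theorem Path.extend_of_mem (γ : Path T F) {t : ℝ} (ht : t ∈ Icc 0 T) :
    γ.extend hT t = γ ⟨t, ht⟩ := by
  rw [Path.extend, projIcc_of_mem hT ht]

variable [NormedSpace ℝ F]

/-- The primitive `t ↦ ∫_0^t γ(s) ds`. -/
def primCLM : Path T F →L[ℝ] Path T F :=
  LinearMap.mkContinuous
    { toFun := fun γ => ⟨fun t => ∫ s in (0 : ℝ)..t, γ.extend hT s,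
        (intervalIntegral.continuous_primitive
          (fun a b => (γ.continuous_extend hT).intervalIntegrable a b) 0).comp
          continuous_subtype_val⟩
      map_add' := fun γ γ' => by
        ext t
        exact intervalIntegral.integral_add ((γ.continuous_extend hT).intervalIntegrable _ _)
          ((γ'.continuous_extend hT).intervalIntegrable _ _)
      map_smul' := fun c γ => by
        ext t
        exact intervalIntegral.integral_smul c _ }
    T fun γ => by
      rw [ContinuousMap.norm_le _ (by positivity)]
      intro t
      refine (intervalIntegral.norm_integral_le_of_norm_le_const
        fun s _ => γ.norm_extend_le hT s).trans ?_
      rw [sub_zero, abs_of_nonneg t.2.1, mul_comm]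
      gcongr
      exact t.2.2

theorem primCLM_apply (γ : Path T F) (t : Icc (0 : ℝ) T) :
    primCLM hT γ t = ∫ s in (0 : ℝ)..t, γ.extend hT s := rfl

/-- The Volterra operator `h ↦ ∫_0^t A(s) h(s) ds`. -/
def volterra (A : Path T (F →L[ℝ] F)) : Path T F →L[ℝ] Path T F :=
  primCLM hT ∘L applyCLM _ _ _ A

/-- Integrating `s ^ n / n!` gains the factor `t / (n + 1)` at each iteration; this factorial decay
removes any smallness condition on `T`. -/
theorem norm_volterra_pow_apply_le (A : Path T (F →L[ℝ] F)) (h : Path T F) (n : ℕ)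
    (t : Icc (0 : ℝ) T) :
    ‖(volterra hT A ^ n) h t‖ ≤ ‖A‖ ^ n * ‖h‖ * (t : ℝ) ^ n / n.factorial := by
  induction n generalizing t with
  | zero => simpa using h.norm_coe_le_norm t
  | succ n ih =>
    rw [pow_succ']
    change ‖∫ s in (0 : ℝ)..t, Path.extend hT (applyCLM _ _ _ A ((volterra hT A ^ n) h)) s‖ ≤ _
    have hb : ∀ s ∈ Ioc (0 : ℝ) t, ‖Path.extend hT (applyCLM _ _ _ A ((volterra hT A ^ n) h)) s‖ ≤
        ‖A‖ ^ (n + 1) * ‖h‖ / n.factorial * s ^ n := by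
      intro s hs
      have hs' : s ∈ Icc 0 T := ⟨hs.1.le, hs.2.trans t.2.2⟩
      rw [Path.extend_of_mem hT _ hs', applyCLM_apply]
      refine ((A _).le_of_opNorm_le_of_le (A.norm_coe_le_norm _) (ih ⟨s, hs'⟩)).trans (le_of_eq ?_)
      simp only
      ring
    refine (intervalIntegral.norm_integral_le_of_norm_le t.2.1 (.of_forall hb)
      (Continuous.intervalIntegrable (by fun_prop) _ _)).trans (le_of_eq ?_)
    rw [intervalIntegral.integral_const_mul, integral_pow, Nat.factorial_succ]
    have : (n.factorial : ℝ) ≠ 0 := by positivity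
    push_cast
    field_simp
    simp

/-- Some power `A ^ n` has norm below one, so `1 - A ^ n` is a unit. It is the product of the
commuting factors `1 - A` and a geometric sum, so `1 - A` is a unit too. -/
theorem isUnit_one_sub_volterra [CompleteSpace F] (A : Path T (F →L[ℝ] F)) :
    IsUnit (1 - volterra hT A) := by
  have hlim := FloorSemiring.tendsto_pow_div_factorial_atTop (‖A‖ * T)
  obtain ⟨n, hn⟩ := (hlim.eventually_lt_const one_pos).exists
  have h1 : ‖volterra hT A ^ n‖ < 1 := by
    refine lt_of_le_of_lt (ContinuousLinearMap.opNorm_le_bound _ (by positivity) fun h => ?_) hn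
    rw [ContinuousMap.norm_le _ (by positivity)]
    intro t
    refine (norm_volterra_pow_apply_le hT A h n t).trans ?_
    rw [mul_pow, div_mul_eq_mul_div, mul_right_comm]
    gcongr
    · exact t.2.1
    · exact t.2.2
  have h2 := isUnit_one_sub_of_norm_lt_one (R := Path T F →L[ℝ] Path T F)
    (x := volterra hT A ^ n) h1
  rw [← mul_neg_geom_sum] at h2
  exact ((Commute.isUnit_mul_iff (by
    rw [commute_iff_eq, mul_neg_geom_sum, geom_sum_mul_neg])).1 h2).1

theorem Path.hasDerivAt_add_integral [CompleteSpace F] (c : F) (z : Path T F) (t : ℝ) :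
    HasDerivAt (fun t => c + ∫ s in (0 : ℝ)..t, z.extend hT s) (z.extend hT t) t :=
  (intervalIntegral.integral_hasDerivAt_right
    ((z.continuous_extend hT).intervalIntegrable _ _)
    ((z.continuous_extend hT).stronglyMeasurableAtFilter _ _)
    (z.continuous_extend hT).continuousAt).const_add c

end Volterra

/-! ### Uniqueness and `C²` dependence on the initial value. -/

section FlowMap

variable {T : ℝ} (hT : 0 ≤ T) {X : Type*} [NormedAddCommGroup X] [NormedSpace ℝ X]
  [CompleteSpace X]

/-- Solutions of an integral equation with Lipschitz right-hand side that agree at one time are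
equal. -/
theorem Path.eq_of_eq_add_primCLM {f : Icc (0 : ℝ) T → X → X}
    (hf : Continuous (Function.uncurry f)) {K : NNReal} (hK : ∀ s, LipschitzWith K (f s))
    {γ₁ γ₂ : Path T X} {c₁ c₂ : X}
    (h₁ : γ₁ = ContinuousMap.const _ c₁ + primCLM hT (nemytskii f hf γ₁))
    (h₂ : γ₂ = ContinuousMap.const _ c₂ + primCLM hT (nemytskii f hf γ₂))
    {t₀ : Icc (0 : ℝ) T} (h0 : γ₁ t₀ = γ₂ t₀) : γ₁ = γ₂ := by
  -- The integrand extended by constants gives a curve on the real line that is differentiable at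
  -- the endpoints of `[0,T]` too.
  let y : Path T X → X → ℝ → X := fun γ c t => c + ∫ s in (0 : ℝ)..t,
    Path.extend hT (nemytskii f hf γ) s
  have hy : ∀ {γ : Path T X} {c : X},
      γ = ContinuousMap.const _ c + primCLM hT (nemytskii f hf γ) →
      ∀ t : Icc (0 : ℝ) T, γ t = y γ c t := by
    intro γ c h t
    exact congrArg (fun g : Path T X => g t) h
  let v : ℝ → X → X := fun t x => f (projIcc 0 T hT t) x
  have hd : ∀ {γ : Path T X} {c : X},
      γ = ContinuousMap.const _ c + primCLM hT (nemytskii f hf γ) →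
      ∀ t ∈ Icc 0 T, HasDerivAt (y γ c) (v t (y γ c t)) t := by
    intro γ c h t ht
    convert Path.hasDerivAt_add_integral hT c (nemytskii f hf γ) t using 1
    have h1 := hy h ⟨t, ht⟩
    simp only [v, Path.extend, nemytskii_apply, projIcc_of_mem hT ht, h1]
  have hv : ∀ t, LipschitzOnWith K (v t) univ := fun t => (hK _).lipschitzOnWith
  have hc : ∀ {γ : Path T X} {c : X},
      γ = ContinuousMap.const _ c + primCLM hT (nemytskii f hf γ) →
      ContinuousOn (y γ c) (Icc 0 T) := fun h t ht =>
    (hd h t ht).continuousAt.continuousWithinAt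
  have h0' : y γ₁ c₁ t₀ = y γ₂ c₂ t₀ := by rw [← hy h₁, ← hy h₂, h0]
  ext t
  rw [hy h₁, hy h₂]
  -- Uniqueness runs backward and forward from `t₀`. The backward half gives injectivity of `Φ_t`
  -- and of its differential.
  rcases le_total (t : ℝ) t₀ with h | h
  · have hsub : Icc 0 (t₀ : ℝ) ⊆ Icc 0 T := Icc_subset_Icc_right t₀.2.2
    exact ODE_solution_unique_of_mem_Icc_left (v := v) (s := fun _ => univ) (K := K)
      (fun t _ => hv t) ((hc h₁).mono hsub)
      (fun s hs => (hd h₁ s (hsub (Ioc_subset_Icc_self hs))).hasDerivWithinAt) (fun _ _ => trivial)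
      ((hc h₂).mono hsub)
      (fun s hs => (hd h₂ s (hsub (Ioc_subset_Icc_self hs))).hasDerivWithinAt) (fun _ _ => trivial)
      h0' ⟨t.2.1, h⟩
  · have hsub : Icc (t₀ : ℝ) T ⊆ Icc 0 T := Icc_subset_Icc_left t₀.2.1
    exact ODE_solution_unique_of_mem_Icc_right (v := v) (s := fun _ => univ) (K := K)
      (fun t _ => hv t) ((hc h₁).mono hsub)
      (fun s hs => (hd h₁ s (hsub (Ico_subset_Icc_self hs))).hasDerivWithinAt) (fun _ _ => trivial)
      ((hc h₂).mono hsub)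
      (fun s hs => (hd h₂ s (hsub (Ico_subset_Icc_self hs))).hasDerivWithinAt) (fun _ _ => trivial)
      h0' ⟨h, t.2.2⟩

/-- Solutions of an ordinary differential equation with `C²` right-hand side depend `C²` on the
initial value, as elements of the space of continuous paths. -/
theorem contDiffOn_solution {f : Icc (0 : ℝ) T → X → X} {f' : Icc (0 : ℝ) T → X → X →L[ℝ] X}
    {f'' : Icc (0 : ℝ) T → X → X →L[ℝ] X →L[ℝ] X}
    (hf : Continuous (Function.uncurry f)) (hf' : Continuous (Function.uncurry f'))
    (hf'' : Continuous (Function.uncurry f''))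
    (hd : ∀ s x, HasFDerivAt (f s) (f' s x) x) (hd' : ∀ s x, HasFDerivAt (f' s) (f'' s x) x)
    {K : NNReal} (hK : ∀ s, LipschitzWith K (f s)) {D : Set X} (hD : IsOpen D)
    {γ : X → Path T X}
    (hγ : ∀ x ∈ D, γ x = ContinuousMap.const _ x + primCLM hT (nemytskii f hf (γ x))) :
    ContDiffOn ℝ 2 γ D := by
  have hT0 : (0 : ℝ) ∈ Icc 0 T := ⟨le_rfl, hT⟩
  intro x₀ hx₀
  apply ContDiffAt.contDiffWithinAt
  -- The integral equation reads `H (γ x) = const x`, and the derivative of `H` is the identity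
  -- minus a Volterra operator. The inverse function theorem therefore applies to `H` at `γ x₀`.
  let H : Path T X → Path T X := fun g => g - primCLM hT (nemytskii f hf g)
  have hH : ContDiff ℝ 2 H :=
    have h := (primCLM (F := X) hT).contDiff.comp (contDiff_two_nemytskii hf hf' hf'' hd hd')
    contDiff_id.sub h
  have hHd : HasFDerivAt H (1 - volterra hT (nemytskii f' hf' (γ x₀))) (γ x₀) :=
    have h := (primCLM (F := X) hT).hasFDerivAt.comp _ (hasFDerivAt_nemytskii hf hf' hd (γ x₀))
    (hasFDerivAt_id _).sub h
  obtain ⟨U, hU⟩ := isUnit_one_sub_volterra hT (nemytskii f' hf' (γ x₀))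
  let e : Path T X ≃L[ℝ] Path T X := ContinuousLinearEquiv.unitsEquiv ℝ (Path T X) U
  have he : (e : Path T X →L[ℝ] Path T X) = 1 - volterra hT (nemytskii f' hf' (γ x₀)) := hU
  rw [← he] at hHd
  have hHs := hH.contDiffAt.hasStrictFDerivAt' hHd two_ne_zero
  have hinv := hH.contDiffAt.to_localInverse hHd two_ne_zero
  have hHγ : ∀ x ∈ D, H (γ x) = ContinuousMap.const _ x := fun x hx =>
    sub_eq_of_eq_add (hγ x hx)
  have hconst : ContDiff ℝ 2 fun x : X => (ContinuousMap.const (Icc (0 : ℝ) T) x) := by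
    have : (fun x : X => (ContinuousMap.const (Icc (0 : ℝ) T) x)) =
      (ContinuousLinearMap.const ℝ (Icc (0 : ℝ) T) : X →L[ℝ] C(Icc (0 : ℝ) T, X)) := rfl
    rw [this]
    exact ContinuousLinearMap.contDiff _
  have hr := hHs.eventually_right_inverse
  rw [hHγ x₀ hx₀] at hr hinv
  -- The local inverse also solves the integral equation with initial value `x`. Uniqueness
  -- identifies it with `γ x`, without assuming `γ` continuous.
  have hev : γ =ᶠ[𝓝 x₀] fun x => hH.contDiffAt.localInverse hHd two_ne_zero
      (ContinuousMap.const _ x) := by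
    filter_upwards [hconst.continuous.continuousAt.eventually hr, hD.mem_nhds hx₀] with x hx hxD
    set g := hH.contDiffAt.localInverse hHd two_ne_zero (ContinuousMap.const _ x) with hg
    have h1 : g = ContinuousMap.const _ x + primCLM hT (nemytskii f hf g) :=
      sub_eq_iff_eq_add.1 hx
    refine Path.eq_of_eq_add_primCLM hT hf hK (hγ x hxD) h1 (t₀ := ⟨0, hT0⟩) ?_
    rw [hγ x hxD, h1]
    simp [primCLM_apply]
  exact (hinv.comp x₀ hconst.contDiffAt).congr_of_eventuallyEq hev

end FlowMap

end MovingStokes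

namespace MovingStokes

open Filter

/-! ### Time derivatives of paths. -/

section PathCalculus

variable {T : ℝ} (hT : 0 ≤ T) {X F : Type*} [NormedAddCommGroup X] [NormedSpace ℝ X]
  [NormedAddCommGroup F] [NormedSpace ℝ F]

/-- `y'` is the derivative of the path `y` on `(0,T)`. -/
def HasTimeDeriv (y y' : Path T F) : Prop :=
  ∀ t ∈ Ioo 0 T, HasDerivAt (y.extend hT) (y'.extend hT t) t

variable (F) in
/-- Evaluation of paths at time `t`. -/
def evalPath (t : ℝ) : Path T F →L[ℝ] F := ContinuousMap.evalCLM ℝ (projIcc 0 T hT t)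

variable (T F) in
/-- Constant paths. -/
def constPath : F →L[ℝ] Path T F := ContinuousLinearMap.const ℝ _

variable (T X F) in
/-- An operator with values in paths, seen as a path of operators. -/
def pathOfLM [FiniteDimensional ℝ X] : (X →L[ℝ] Path T F) →ₗ[ℝ] Path T (X →L[ℝ] F) where
  toFun A := ⟨fun t => ContinuousMap.evalCLM ℝ t ∘L A, by
    rw [continuous_clm_apply]
    exact fun v => (A v).continuous⟩
  map_add' A B := by ext; simp
  map_smul' c A := by ext; simp

variable (T X F) in
/-- The continuous version of `pathOfLM`. -/
def pathOfCLM [FiniteDimensional ℝ X] : (X →L[ℝ] Path T F) →L[ℝ] Path T (X →L[ℝ] F) :=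
  ⟨pathOfLM T X F, by
    refine AddMonoidHomClass.continuous_of_bound (pathOfLM T X F) 1 fun A => ?_
    rw [ContinuousMap.norm_le _ (by positivity), one_mul]
    intro t
    refine ContinuousLinearMap.opNorm_le_bound _ (norm_nonneg _) fun v => ?_
    exact ((A v).norm_coe_le_norm t).trans (A.le_opNorm v)⟩

/-- The integral form is linear in `y` and `y'` and uses only bounded operators, so it can be
differentiated in a parameter. With the converse below, this is how time and space derivatives are
interchanged. -/
theorem HasTimeDeriv.eq_const_add_primCLM [CompleteSpace F] {y y' : Path T F}
    (h : HasTimeDeriv hT y y') :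
    y = constPath T F (y ⟨0, le_rfl, hT⟩) + primCLM hT y' := by
  ext t
  have h1 := intervalIntegral.integral_eq_sub_of_hasDerivAt_of_le t.2.1
    (y.continuous_extend hT).continuousOn
    (fun s hs => h s ⟨hs.1, hs.2.trans_le t.2.2⟩)
    ((y'.continuous_extend hT).intervalIntegrable _ _)
  change y t = y ⟨0, le_rfl, hT⟩ + ∫ s in (0 : ℝ)..t, y'.extend hT s
  rw [h1, Path.extend_of_mem hT y t.2, Path.extend_of_mem hT y ⟨le_rfl, hT⟩]
  abel

theorem hasTimeDeriv_of_eq_const_add_primCLM [CompleteSpace F] {y y' : Path T F} {c : F}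
    (h : y = constPath T F c + primCLM hT y') : HasTimeDeriv hT y y' := by
  intro t ht
  refine (Path.hasDerivAt_add_integral hT c y' t).congr_of_eventuallyEq ?_
  filter_upwards [Icc_mem_nhds ht.1 ht.2] with s hs
  rw [Path.extend_of_mem hT y hs]
  exact congrArg (fun g : Path T F => g ⟨s, hs⟩) h

/-- Derivatives in time and with respect to a parameter commute. -/
theorem hasTimeDeriv_fderiv [CompleteSpace F] {f f' : X → Path T F} {x : X}
    (hf : DifferentiableAt ℝ f x) (hf' : DifferentiableAt ℝ f' x)
    (h : ∀ᶠ y in 𝓝 x, HasTimeDeriv hT (f y) (f' y)) (v : X) :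
    HasTimeDeriv hT (fderiv ℝ f x v) (fderiv ℝ f' x v) := by
  let e0 : Path T F →L[ℝ] F := evalPath hT F 0
  have h1 : f =ᶠ[𝓝 x] fun y => constPath T F (e0 (f y)) + primCLM hT (f' y) := by
    filter_upwards [h] with y hy
    refine (hy.eq_const_add_primCLM hT).trans ?_
    congr 2
    exact (Path.extend_of_mem hT (f y) ⟨le_rfl, hT⟩).symm
  have h2 : HasFDerivAt f ((constPath T F ∘L e0) ∘L fderiv ℝ f x +
      primCLM hT ∘L fderiv ℝ f' x) x := by
    refine HasFDerivAt.congr_of_eventuallyEq ?_ h1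
    have h3 := (primCLM (F := F) hT).hasFDerivAt.comp x hf'.hasFDerivAt
    exact ((constPath T F ∘L e0).hasFDerivAt.comp x hf.hasFDerivAt).add h3
  have h3 := congrArg (fun L : X →L[ℝ] Path T F => L v) h2.fderiv
  exact hasTimeDeriv_of_eq_const_add_primCLM hT h3

end PathCalculus

/-! ### Curves in `H^1_0` from families of paths. -/

section PathCurves

variable {d : ℕ} {Ω : Set (E d)} {T : ℝ} (hT : 0 ≤ T)

/-- A `C¹` family of paths with compact support in `Ω` whose time derivative is also `C¹` yields,
after a cutoff in time, a `C¹` curve in `H^1_0(Ω)`. -/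
theorem exists_H10_curve_of_path (hΩ : IsOpen Ω) [IsFiniteMeasure (volume.restrict Ω)]
    {f f' : E d → Path T (E d)} (hf : ContDiff ℝ 1 f) (hf' : ContDiff ℝ 1 f')
    (hff' : ∀ x, HasTimeDeriv hT (f x) (f' x)) {K : Set (E d)} (hK : IsCompact K) (hKΩ : K ⊆ Ω)
    (hfK : Function.support f ⊆ K) {ψ : ℝ → ℝ} (hψ : ContDiff ℝ ∞ ψ) (hψc : HasCompactSupport ψ)
    (hψT : tsupport ψ ⊆ Ioo 0 T) :
    ∃ η : ℝ → H10 Ω, ContDiff ℝ 1 η ∧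
      (∀ t, H10.fn (η t) =ᵐ[volume.restrict Ω] fun x => ψ t • (f x).extend hT t) ∧
      (∀ t, H10.fn (deriv η t) =ᵐ[volume.restrict Ω]
        fun x => deriv ψ t • (f x).extend hT t + ψ t • (f' x).extend hT t) ∧
      tsupport η ⊆ tsupport ψ := by
  have hψd : ∀ t, HasDerivAt ψ (deriv ψ t) t := fun t =>
    (hψ.differentiable (by simp) t).hasDerivAt
  have hψ' : Continuous (deriv ψ) := hψ.continuous_deriv (by simp)
  have hjoint : ∀ g : E d → Path T (E d), Continuous g →
      Continuous fun p : ℝ × E d => (g p.2).extend hT p.1 := fun g hg =>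
    (hg.comp continuous_snd).eval ((continuous_projIcc (h := hT)).comp continuous_fst)
  have hfd := hf.continuous_fderiv one_ne_zero
  have hfd' := hf'.continuous_fderiv one_ne_zero
  have hmul : ∀ (y y' : Path T (E d)), HasTimeDeriv hT y y' → ∀ t,
      HasDerivAt (fun s => ψ s • y.extend hT s)
        (deriv ψ t • y.extend hT t + ψ t • y'.extend hT t) t := by
    intro y y' hy t
    -- The paths are known to be differentiable only inside `(0,T)`; elsewhere the cutoff vanishes
    -- near `t`.
    by_cases ht : t ∈ tsupport ψ
    · rw [add_comm]
      exact (hψd t).smul (hy t (hψT ht))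
    · have h0 : ψ =ᶠ[𝓝 t] fun _ => 0 := notMem_tsupport_iff_eventuallyEq.mp ht
      have h1 : deriv ψ t = 0 := by rw [h0.deriv_eq]; simp
      rw [h1, h0.eq_of_nhds, zero_smul, zero_smul, add_zero]
      refine (hasDerivAt_const t (0 : E d)).congr_of_eventuallyEq ?_
      filter_upwards [h0] with s hs
      rw [hs, zero_smul]
  have hgrad : ∀ t x, gradMat (fun x => ψ t • (f x).extend hT t) x =
      WithLp.toLp 2 fun i => ψ t • (fderiv ℝ f x (stdVec i)).extend hT t := by
    intro t x
    have h1 : HasFDerivAt (fun x => ψ t • (f x).extend hT t)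
        (ψ t • (evalPath hT (E d) t ∘L fderiv ℝ f x)) x :=
      ((evalPath hT (E d) t).hasFDerivAt.comp x
        (hf.differentiable one_ne_zero x).hasFDerivAt).const_smul (ψ t)
    rw [gradMat, h1.fderiv]
    rfl
  have hcB : ∀ (c : ℝ → ℝ) (g : E d → Path T (E d)), Continuous c → Continuous (fderiv ℝ g) →
      ∀ i : Fin d, Continuous fun p : ℝ × E d =>
        c p.1 • (fderiv ℝ g p.2 (stdVec i)).extend hT p.1 := fun c g hc hg i =>
    (hc.comp continuous_fst).smul
      (hjoint (fun x => fderiv ℝ g x (stdVec i)) (hg.clm_apply continuous_const))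
  refine exists_H10_curve (J := tsupport ψ) (K := K)
    (F := fun t x => ψ t • (f x).extend hT t)
    (F' := fun t x => deriv ψ t • (f x).extend hT t + ψ t • (f' x).extend hT t)
    (B' := fun t x => WithLp.toLp 2 fun i => deriv ψ t • (fderiv ℝ f x (stdVec i)).extend hT t +
      ψ t • (fderiv ℝ f' x (stdVec i)).extend hT t)
    hΩ hψc hK hKΩ ?_ ?_ ?_ ?_ ?_ ?_ ?_ ?_
  · rintro ⟨t, x⟩ h
    refine ⟨subset_tsupport _ fun h0 => h ?_, ?_⟩
    · simp [Function.uncurry, h0]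
    · by_contra hx
      apply h
      have : f x = 0 := Function.notMem_support.mp fun h' => hx (hfK h')
      simp [Function.uncurry, this, Path.extend]
  · intro t
    exact ((evalPath hT (E d) t).contDiff.comp hf).const_smul (ψ t)
  · exact (hψ.continuous.comp continuous_fst).smul (hjoint f hf.continuous)
  · exact ((hψ'.comp continuous_fst).smul (hjoint f hf.continuous)).add
      ((hψ.continuous.comp continuous_fst).smul (hjoint f' hf'.continuous))
  · simp only [Function.uncurry_def, hgrad]
    exact (PiLp.continuous_toLp 2 _).comp
      (continuous_pi fun i => hcB ψ f hψ.continuous hfd i)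
  · exact (PiLp.continuous_toLp 2 _).comp
      (continuous_pi fun i => (hcB _ f hψ' hfd i).add (hcB _ f' hψ.continuous hfd' i))
  · exact fun t x => hmul _ _ (hff' x) t
  · intro t x
    simp only [hgrad]
    have h1 : HasDerivAt (fun s i => ψ s • (fderiv ℝ f x (stdVec i)).extend hT s)
        (fun i => deriv ψ t • (fderiv ℝ f x (stdVec i)).extend hT t +
          ψ t • (fderiv ℝ f' x (stdVec i)).extend hT t) t := by
      rw [hasDerivAt_pi]
      intro i
      exact hmul _ _ (hasTimeDeriv_fderiv hT (hf.differentiable one_ne_zero x)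
        (hf'.differentiable one_ne_zero x) (.of_forall hff') (stdVec i)) t
    exact (PiLp.continuousLinearEquiv 2 ℝ (fun _ : Fin d => E d)).symm.hasFDerivAt.comp_hasDerivAt
      t h1

end PathCurves

end MovingStokes

namespace MovingStokes

open Filter

variable {d : ℕ}

/-! ### Regularity of the velocity field. -/

section Velocity

/-- A velocity field is given on `[0,T] × D` by a field that is `C²` in space, with derivatives
that are jointly continuous, and Lipschitz in space. -/
theorem IsVelocityField.exists_field {D : Set (E d)} {T : ℝ} {w : ℝ → E d → E d}
    (hw : IsVelocityField D T w) :
    ∃ (f : Icc (0 : ℝ) T → E d → E d) (f' : Icc (0 : ℝ) T → E d → E d →L[ℝ] E d)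
      (f'' : Icc (0 : ℝ) T → E d → E d →L[ℝ] E d →L[ℝ] E d) (K : NNReal),
      Continuous (Function.uncurry f) ∧ Continuous (Function.uncurry f') ∧
      Continuous (Function.uncurry f'') ∧ (∀ s x, HasFDerivAt (f s) (f' s x) x) ∧
      (∀ s x, HasFDerivAt (f' s) (f'' s x) x) ∧ (∀ s, LipschitzWith K (f s)) ∧
      ∀ s : Icc (0 : ℝ) T, ∀ x ∈ D, w s x = f s x := by
  obtain ⟨⟨k, hk, K, -, W, W', hW, -, hwW⟩, -⟩ := hw
  have hWc : Continuous fun s : Icc (0 : ℝ) T => W s :=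
    continuousOn_iff_continuous_domRestrict.mp fun t ht => (hW t ht).hasFDerivWithinAt.continuousWithinAt
  -- Differentiation is continuous for the `C^k` topologies. Two orders are taken from `k ≥ 2`, and
  -- continuity in time with values in these spaces gives joint continuity.
  let L1 := ContDiffMapSupportedIn.fderivCLM (E := E d) (F := E d) (K := K) ℝ (k : ℕ∞) 1
  let L2 := ContDiffMapSupportedIn.fderivCLM (E := E d) (F := E d →L[ℝ] E d) (K := K) ℝ (1 : ℕ∞) 0
  have hk2 : (1 : ℕ∞) + 1 ≤ k := by
    rw [one_add_one_eq_two]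
    exact_mod_cast hk
  have e1 : ∀ s : Icc (0 : ℝ) T, ⇑(L1 (W s)) = fderiv ℝ (W s) := fun s =>
    ContDiffMapSupportedIn.fderivCLM_apply_of_le ℝ (W s) hk2
  have e2 : ∀ s : Icc (0 : ℝ) T, ⇑(L2 (L1 (W s))) = fderiv ℝ (L1 (W s)) := fun s =>
    ContDiffMapSupportedIn.fderivCLM_apply_of_le ℝ (L1 (W s)) (by simp)
  have hW1 : Continuous fun s : Icc (0 : ℝ) T => L1 (W s) := L1.continuous.comp hWc
  have hW2 : Continuous fun s : Icc (0 : ℝ) T => L2 (L1 (W s)) := L2.continuous.comp hW1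
  have hd : ∀ (s : Icc (0 : ℝ) T) x, HasFDerivAt (W s) (L1 (W s) x) x := fun s x => by
    rw [e1]
    refine ((W s).contDiff.differentiable ?_ x).hasFDerivAt
    have : k ≠ 0 := by omega
    exact_mod_cast this
  have hd' : ∀ (s : Icc (0 : ℝ) T) x, HasFDerivAt (L1 (W s)) (L2 (L1 (W s)) x) x := fun s x => by
    rw [e2]
    exact ((L1 (W s)).contDiff.differentiable (by simp) x).hasFDerivAt
  have hB : Continuous fun s : Icc (0 : ℝ) T =>
      ContDiffMapSupportedIn.toBoundedContinuousFunctionCLM ℝ (L1 (W s)) :=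
    (ContDiffMapSupportedIn.toBoundedContinuousFunctionCLM ℝ).continuous.comp hW1
  -- The Lipschitz constant is a bound for the sup norm of the spatial derivative over the compact
  -- interval `[0,T]`.
  obtain ⟨C, hC⟩ := isCompact_univ.exists_bound_of_continuousOn hB.norm.continuousOn
  refine ⟨fun s => W s, fun s => L1 (W s), fun s => L2 (L1 (W s)), Real.toNNReal C,
    (hWc.comp continuous_fst).eval continuous_snd, (hW1.comp continuous_fst).eval continuous_snd,
    (hW2.comp continuous_fst).eval continuous_snd, hd, hd', fun s => ?_,
    fun s x hx => hwW s s.2 x hx⟩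
  refine lipschitzWith_of_nnnorm_fderiv_le (𝕜 := ℝ) (fun x => (hd s x).differentiableAt) fun x => ?_
  rw [← e1, ← norm_toNNReal]
  refine Real.toNNReal_le_toNNReal ?_
  have h := hC s (mem_univ s)
  rw [norm_norm] at h
  exact (BoundedContinuousFunction.norm_coe_le_norm _ x).trans h

end Velocity

/-! ### The flow as a `C²` family of paths. -/

section Flow

variable {D : Set (E d)} {T : ℝ} {hT : 0 ≤ T} {Φ : ℝ → E d → E d}

variable (D hT Φ) in
/-- The flow `Φ`, seen as a `C²` family `γ` of paths with derivative `z` in time. -/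
structure IsPathFlow (γ z : E d → Path T (E d)) : Prop where
  contDiffOn : ContDiffOn ℝ 2 γ D
  contDiffOn_deriv : ContDiffOn ℝ 2 z D
  hasTimeDeriv : ∀ x ∈ D, HasTimeDeriv hT (γ x) (z x)
  apply_eq : ∀ x ∈ D, ∀ t : Icc (0 : ℝ) T, γ x t = Φ t x
  injOn : ∀ t ∈ Icc 0 T, InjOn (Φ t) D
  isUnit : ∀ x ∈ D, ∀ t, IsUnit (pathOfCLM T (E d) (E d) (fderiv ℝ γ x) t)

/-- The time derivative is `z = f(·, γ)`, as smooth as `γ`. Injectivity of `Φ_t` is uniqueness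
started at time `t`. The same argument for the linearised equation makes `DΦ_t` injective, hence
invertible in finite dimension. -/
theorem IsFlow.exists_isPathFlow (hD : IsOpen D) {w : ℝ → E d → E d} (hw : IsVelocityField D T w)
    (hΦ : IsFlow D T w Φ) : ∃ γ z, IsPathFlow D hT Φ γ z := by
  obtain ⟨f, f', f'', K, hf, hf', hf'', hd, hd', hK, hwf⟩ := hw.exists_field
  have hT0 : (0 : ℝ) ∈ Icc 0 T := ⟨le_rfl, hT⟩
  have hc : ∀ x ∈ D, Continuous fun t : Icc (0 : ℝ) T => Φ t x := fun x hx =>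
    continuousOn_iff_continuous_domRestrict.mp fun t ht => (hΦ.2 t ht x hx).2.continuousWithinAt
  classical
  let γ : E d → Path T (E d) := fun x => if h : x ∈ D then ⟨fun t => Φ t x, hc x h⟩ else 0
  have hγ : ∀ x ∈ D, ∀ t : Icc (0 : ℝ) T, γ x t = Φ t x := fun x hx t => by
    simp only [γ, dif_pos hx, ContinuousMap.coe_mk]
  have htd : ∀ x ∈ D, HasTimeDeriv hT (γ x) (nemytskii f hf (γ x)) := by
    intro x hx t ht
    have ht' := Ioo_subset_Icc_self ht
    have h1 := ((hΦ.2 t ht' x hx).2).hasDerivAt (Icc_mem_nhds ht.1 ht.2)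
    have e : Path.extend hT (nemytskii f hf (γ x)) t = w t (Φ t x) := by
      rw [Path.extend_of_mem hT _ ht', nemytskii_apply, hγ x hx]
      exact (hwf ⟨t, ht'⟩ _ (hΦ.2 t ht' x hx).1).symm
    rw [e]
    refine h1.congr_of_eventuallyEq ?_
    filter_upwards [Icc_mem_nhds ht.1 ht.2] with s hs
    rw [Path.extend_of_mem hT _ hs, hγ x hx]
  have hint : ∀ x ∈ D, γ x = constPath T (E d) x + primCLM hT (nemytskii f hf (γ x)) := by
    intro x hx
    have := (htd x hx).eq_const_add_primCLM hT
    rwa [hγ x hx, hΦ.1 x hx] at this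
  have hγ2 : ContDiffOn ℝ 2 γ D := contDiffOn_solution hT hf hf' hf'' hd hd' hK hD hint
  refine ⟨γ, fun x => nemytskii f hf (γ x), hγ2,
    (contDiff_two_nemytskii hf hf' hf'' hd hd').comp_contDiffOn hγ2, htd, hγ, ?_, ?_⟩
  · intro t ht x hx y hy hxy
    have h := Path.eq_of_eq_add_primCLM hT hf hK (hint x hx) (hint y hy) (t₀ := ⟨t, ht⟩)
      (by rw [hγ x hx, hγ y hy]; exact hxy)
    have h0 := congrArg (fun g : Path T (E d) => g ⟨0, hT0⟩) h
    simp only [hγ x hx, hγ y hy, hΦ.1 x hx, hΦ.1 y hy] at h0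
    exact h0
  · intro x hx t
    have hγd : HasFDerivAt γ (fderiv ℝ γ x) x :=
      ((hγ2.differentiableOn two_ne_zero).differentiableAt (hD.mem_nhds hx)).hasFDerivAt
    let A : Path T (E d →L[ℝ] E d) := nemytskii f' hf' (γ x)
    have hder : HasFDerivAt γ (constPath T (E d) +
        primCLM hT ∘L (applyCLM _ _ _ A) ∘L fderiv ℝ γ x) x := by
      have h1 : γ =ᶠ[𝓝 x] fun y => constPath T (E d) y + primCLM hT (nemytskii f hf (γ y)) := by
        filter_upwards [hD.mem_nhds hx] with y hy using hint y hy
      refine HasFDerivAt.congr_of_eventuallyEq ?_ h1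
      have h2 := (primCLM (F := E d) hT).hasFDerivAt.comp x
        ((hasFDerivAt_nemytskii hf hf' hd (γ x)).comp x hγd)
      exact (constPath T (E d)).hasFDerivAt.add h2
    have hinj : Function.Injective (pathOfCLM T (E d) (E d) (fderiv ℝ γ x) t) := by
      rw [injective_iff_map_eq_zero]
      intro h h0
      have hA : Continuous (Function.uncurry fun s (v : E d) => A s v) := by
        simp only [Function.uncurry_def]
        fun_prop
      have hAK : ∀ s, LipschitzWith ‖A‖₊ fun v => A s v := fun s =>
        (A s).lipschitz.weaken (A.norm_coe_le_norm s)
      -- The path `t ↦ DΦ_t(x) h` solves the linear equation with coefficient `A` and initial value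
      -- `h`. If it vanishes at one time it is the zero solution, so `h = 0`.
      have hy : fderiv ℝ γ x h = ContinuousMap.const _ h +
          primCLM hT (nemytskii (fun s (v : E d) => A s v) hA (fderiv ℝ γ x h)) := by
        conv_lhs => rw [hder.fderiv]
        rfl
      have h00 : (0 : Path T (E d)) = ContinuousMap.const _ 0 +
          primCLM hT (nemytskii (fun s (v : E d) => A s v) hA 0) := by
        have : nemytskii (fun s (v : E d) => A s v) hA 0 = 0 := by
          ext s
          simp
        rw [this, map_zero, add_zero]
        rfl
      have h1 := Path.eq_of_eq_add_primCLM hT hA hAK hy h00 (t₀ := t) h0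
      rw [h1] at hy
      have h2 := congrArg (fun g : Path T (E d) => g ⟨0, hT0⟩) hy
      have h3 : nemytskii (fun s (v : E d) => A s v) hA 0 = 0 := by
          ext s
          simp
      rw [h3, map_zero] at h2
      simpa using h2.symm
    rw [ContinuousLinearMap.isUnit_iff_bijective]
    exact ⟨hinj, LinearMap.injective_iff_surjective.mp hinj⟩

end Flow

end MovingStokes

namespace MovingStokes

open Filter

/-! ### Calculus in the Banach algebra of operator paths. -/

section Algebra

/-- The cancellation behind the theorem, with `y = DΦ_t`, `y' = DΦ_t⁻¹`, `r = DΦ_t⁻ᵀ` and `z = d/dt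
(DΦ_tᵀ DΦ_t)`. The first term is `DΦ_t` times the time derivative of the inverse metric `y' * r`;
the second is the matrix of `λ` times `r`. -/
theorem mul_neg_add_mul_eq_zero {S : Type*} [Ring S] {y y' : S} (h : y * y' = 1) (r z : S) :
    y * -(y' * r * z * (y' * r)) + r * (z * y') * r = 0 := by
  have h1 : y * (y' * r * z * (y' * r)) = y * y' * (r * (z * y') * r) := by noncomm_ring
  rw [mul_neg, h1, h, one_mul, neg_add_cancel]

variable {T : ℝ} {hT : 0 ≤ T} {R : Type*} [NormedRing R]

variable (R) in
/-- Evaluation of paths as a multiplicative map. -/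
def Path.evalHom (t : Icc (0 : ℝ) T) : Path T R →* R where
  toFun y := y t
  map_one' := rfl
  map_mul' _ _ := rfl

theorem Path.ringInverse_apply {y : Path T R} (hy : IsUnit y) (t : Icc (0 : ℝ) T) :
    Ring.inverse y t = Ring.inverse (y t) := by
  obtain ⟨u, rfl⟩ := hy
  rw [Ring.inverse_unit]
  exact (Ring.inverse_unit (Units.map (Path.evalHom R t) u)).symm

theorem Path.isUnit_star_mul_self [CompleteSpace R] [StarRing R] [NormedStarGroup R] {y : Path T R}
    (hy : ∀ t, IsUnit (y t)) : IsUnit (star y * y) := by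
  rw [ContinuousMap.isUnit_iff_forall_isUnit]
  exact fun t => (hy t).star.mul (hy t)

variable [NormedAlgebra ℝ R]

theorem HasTimeDeriv.mul {y y' z z' : Path T R} (hy : HasTimeDeriv hT y y')
    (hz : HasTimeDeriv hT z z') : HasTimeDeriv hT (y * z) (y' * z + y * z') := fun t ht =>
  (hy t ht).mul (hz t ht)

theorem HasTimeDeriv.star [StarRing R] [NormedStarGroup R] [StarModule ℝ R] {y y' : Path T R}
    (hy : HasTimeDeriv hT y y') : HasTimeDeriv hT (star y) (star y') := fun t ht => (hy t ht).star

theorem HasTimeDeriv.ringInverse [HasSummableGeomSeries R] {y y' : Path T R} (hu : IsUnit y)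
    (hy : HasTimeDeriv hT y y') :
    HasTimeDeriv hT (Ring.inverse y) (-(Ring.inverse y * y' * Ring.inverse y)) := by
  intro t ht
  have h1 : ∀ s : Icc (0 : ℝ) T, IsUnit (y s) := fun s =>
    hu.map (Path.evalHom R s)
  obtain ⟨v, hv⟩ := h1 (projIcc 0 T hT t)
  have h2 := hasFDerivAt_ringInverse (𝕜 := ℝ) v
  rw [hv] at h2
  have h3 := HasFDerivAt.comp_hasDerivAt t (f := Path.extend hT y) h2 (hy t ht)
  have h4 : Path.extend hT (Ring.inverse y) = Ring.inverse ∘ Path.extend hT y := by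
    ext s
    exact Path.ringInverse_apply hu _
  rw [h4]
  convert h3 using 1
  rw [← Ring.inverse_unit v, hv, ← Path.ringInverse_apply hu]
  simp [Path.extend]

variable {X : Type*} [NormedAddCommGroup X] [NormedSpace ℝ X] {s : Set X} {n : ℕ∞ω}

theorem Path.contDiffOn_mul {f g : X → Path T R} (hf : ContDiffOn ℝ n f s)
    (hg : ContDiffOn ℝ n g s) : ContDiffOn ℝ n (fun x => f x * g x) s :=
  hf.mul hg

theorem Path.contDiffOn_star [StarRing R] [NormedStarGroup R] [StarModule ℝ R] {f : X → Path T R}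
    (hf : ContDiffOn ℝ n f s) : ContDiffOn ℝ n (fun x => star (f x)) s :=
  (starL' ℝ : Path T R ≃L[ℝ] _).contDiff.comp_contDiffOn hf

theorem Path.contDiffOn_ringInverse [CompleteSpace R] {f : X → Path T R}
    (hf : ContDiffOn ℝ n f s) (hu : ∀ x ∈ s, IsUnit (f x)) :
    ContDiffOn ℝ n (fun x => Ring.inverse (f x)) s := by
  intro x hx
  obtain ⟨u, h⟩ := hu x hx
  have h1 := contDiffAt_ringInverse (n := n) ℝ u
  rw [h] at h1
  exact h1.comp_contDiffWithinAt x (hf x hx)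

end Algebra

theorem contDiff_pathOfCLM {T : ℝ} {X F : Type*} [NormedAddCommGroup X] [NormedSpace ℝ X]
    [FiniteDimensional ℝ X] [NormedAddCommGroup F] [NormedSpace ℝ F] {n : ℕ∞ω} :
    ContDiff ℝ n (pathOfCLM T X F) := by
  fun_prop

/-! ### Jacobian, metric and pullback of gradients along the flow. -/

section Flow

variable {d : ℕ} {D : Set (E d)} {T : ℝ} {hT : 0 ≤ T} {Φ : ℝ → E d → E d}
  {γ z : E d → Path T (E d)}

variable (T) in
/-- The derivative of a family of paths, as a path of operators. -/
def jacobianPath (γ : E d → Path T (E d)) (x : E d) : Path T (E d →L[ℝ] E d) :=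
  pathOfCLM T (E d) (E d) (fderiv ℝ γ x)

theorem contDiffOn_jacobianPath (hD : IsOpen D) (hγ : ContDiffOn ℝ 2 γ D) :
    ContDiffOn ℝ 1 (jacobianPath T γ) D := by
  have h1 : ContDiffOn ℝ 1 (fderiv ℝ γ) D := hγ.fderiv_of_isOpen hD one_add_one_eq_two.le
  exact contDiff_pathOfCLM.comp_contDiffOn h1

namespace IsPathFlow

theorem hasFDerivAt (h : IsPathFlow D hT Φ γ z) (hD : IsOpen D) {x : E d} (hx : x ∈ D)
    (t : Icc (0 : ℝ) T) : HasFDerivAt (Φ t) (jacobianPath T γ x t) x := by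
  have h1 : HasFDerivAt γ (fderiv ℝ γ x) x :=
    ((h.contDiffOn.differentiableOn two_ne_zero).differentiableAt (hD.mem_nhds hx)).hasFDerivAt
  have h2 : HasFDerivAt (fun y => γ y t) (ContinuousMap.evalCLM ℝ t ∘L fderiv ℝ γ x) x :=
    ((ContinuousMap.evalCLM ℝ t : Path T (E d) →L[ℝ] E d).hasFDerivAt (x := γ x)).comp x h1
  refine h2.congr_of_eventuallyEq ?_
  filter_upwards [hD.mem_nhds hx] with y hy using (h.apply_eq y hy t).symm

theorem fderiv_eq (h : IsPathFlow D hT Φ γ z) (hD : IsOpen D) {x : E d} (hx : x ∈ D)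
    {t : ℝ} (ht : t ∈ Icc 0 T) : fderiv ℝ (Φ t) x = Path.extend hT (jacobianPath T γ x) t := by
  rw [Path.extend_of_mem hT _ ht]
  exact (h.hasFDerivAt hD hx ⟨t, ht⟩).fderiv

theorem isUnit_fderiv (h : IsPathFlow D hT Φ γ z) (hD : IsOpen D) {x : E d} (hx : x ∈ D)
    {t : ℝ} (ht : t ∈ Icc 0 T) : IsUnit (fderiv ℝ (Φ t) x) := by
  rw [h.fderiv_eq hD hx ht]
  exact h.isUnit x hx _

theorem contDiffOn_flow (h : IsPathFlow D hT Φ γ z) {t : ℝ} (ht : t ∈ Icc 0 T) :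
    ContDiffOn ℝ 2 (Φ t) D :=
  ((ContinuousMap.evalCLM ℝ (⟨t, ht⟩ : Icc (0 : ℝ) T) : Path T (E d) →L[ℝ] E d).contDiff.comp_contDiffOn
    h.contDiffOn).congr fun x hx => (h.apply_eq x hx ⟨t, ht⟩).symm

theorem hasTimeDeriv_jacobianPath (h : IsPathFlow D hT Φ γ z) (hD : IsOpen D) {x : E d}
    (hx : x ∈ D) : HasTimeDeriv hT (jacobianPath T γ x) (jacobianPath T z x) := by
  intro t ht
  have h1 : DifferentiableAt ℝ γ x :=
    (h.contDiffOn.differentiableOn two_ne_zero).differentiableAt (hD.mem_nhds hx)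
  have h2 : DifferentiableAt ℝ z x :=
    (h.contDiffOn_deriv.differentiableOn two_ne_zero).differentiableAt (hD.mem_nhds hx)
  -- The derivative is known along each vector `v`; the integral form assembles these into one
  -- statement about operators.
  have h3 : ∀ v, HasTimeDeriv hT (fderiv ℝ γ x v) (fderiv ℝ z x v) := hasTimeDeriv_fderiv hT h1 h2
    (by filter_upwards [hD.mem_nhds hx] with y hy using h.hasTimeDeriv y hy)
  refine hasTimeDeriv_of_eq_const_add_primCLM hT (c := jacobianPath T γ x ⟨0, le_rfl, hT⟩) ?_ t ht
  ext s v : 2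
  have h4 := congrArg (fun p : Path T (E d) => p s) ((h3 v).eq_const_add_primCLM hT)
  refine Eq.trans h4 ?_
  have h5 : (primCLM hT (jacobianPath T z x) s) v = primCLM hT (fderiv ℝ z x v) s :=
    ContinuousLinearMap.intervalIntegral_apply
      ((Path.continuous_extend hT (jacobianPath T z x)).intervalIntegrable _ _) v
  change _ = jacobianPath T γ x ⟨0, le_rfl, hT⟩ v + (primCLM hT (jacobianPath T z x) s) v
  rw [h5]
  rfl

variable (T) in
/-- The paths `t ↦ DΦ_tᵀ DΦ_t`. -/
def _root_.MovingStokes.metricPath (γ : E d → Path T (E d)) (x : E d) :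
    Path T (E d →L[ℝ] E d) := star (jacobianPath T γ x) * jacobianPath T γ x

variable (T) in
/-- The time derivatives of the paths `t ↦ DΦ_tᵀ DΦ_t`. -/
def _root_.MovingStokes.metricDerivPath (γ z : E d → Path T (E d)) (x : E d) :
    Path T (E d →L[ℝ] E d) :=
  star (jacobianPath T z x) * jacobianPath T γ x + star (jacobianPath T γ x) * jacobianPath T z x

theorem hasTimeDeriv_metricPath (h : IsPathFlow D hT Φ γ z) (hD : IsOpen D) {x : E d}
    (hx : x ∈ D) : HasTimeDeriv hT (metricPath T γ x) (metricDerivPath T γ z x) :=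
  (h.hasTimeDeriv_jacobianPath hD hx).star.mul (h.hasTimeDeriv_jacobianPath hD hx)

theorem isUnit_metricPath (h : IsPathFlow D hT Φ γ z) {x : E d} (hx : x ∈ D) :
    IsUnit (metricPath T γ x) :=
  Path.isUnit_star_mul_self (h.isUnit x hx)

theorem contDiffOn_metricPath (h : IsPathFlow D hT Φ γ z) (hD : IsOpen D) :
    ContDiffOn ℝ 1 (metricPath T γ) D := by
  have h1 := contDiffOn_jacobianPath hD h.contDiffOn
  exact Path.contDiffOn_mul (Path.contDiffOn_star h1) h1

theorem contDiffOn_metricDerivPath (h : IsPathFlow D hT Φ γ z) (hD : IsOpen D) :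
    ContDiffOn ℝ 1 (metricDerivPath T γ z) D := by
  have h1 := contDiffOn_jacobianPath hD h.contDiffOn
  have h2 := contDiffOn_jacobianPath hD h.contDiffOn_deriv
  exact (Path.contDiffOn_mul (Path.contDiffOn_star h2) h1).add
    (Path.contDiffOn_mul (Path.contDiffOn_star h1) h2)

theorem contDiffOn_ringInverse_metricPath (h : IsPathFlow D hT Φ γ z) (hD : IsOpen D) :
    ContDiffOn ℝ 1 (fun x => Ring.inverse (metricPath T γ x)) D :=
  Path.contDiffOn_ringInverse (h.contDiffOn_metricPath hD) fun _ hx => h.isUnit_metricPath hx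

/-- Identifies the derivative inside `lambdaMat`. For `t` in the open interval, nearby times stay in
`[0,T]`, so neither the extension of paths by constants nor the values of `Φ` outside `[0,T]`
matter. -/
theorem deriv_adjoint_comp (h : IsPathFlow D hT Φ γ z) (hD : IsOpen D) {x : E d} (hx : x ∈ D)
    {t : ℝ} (ht : t ∈ Ioo 0 T) :
    deriv (fun s => ContinuousLinearMap.adjoint (fderiv ℝ (Φ s) x) ∘L fderiv ℝ (Φ s) x) t =
      Path.extend hT (metricDerivPath T γ z x) t := by
  refine HasDerivAt.deriv ((h.hasTimeDeriv_metricPath hD hx t ht).congr_of_eventuallyEq ?_)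
  filter_upwards [Icc_mem_nhds ht.1 ht.2] with s hs
  rw [h.fderiv_eq hD hx hs]
  rfl

/-- The pullback of a gradient field `∇(q ∘ Φ_t⁻¹)` by the Piola transform is the `C¹` family of
paths `(DΦ_tᵀ DΦ_t)⁻¹ ∇q`, and its strong material derivative is cancelled by `λ`. -/
theorem exists_pullback_gradient (h : IsPathFlow D hT Φ γ z) (hD : IsOpen D) {b : E d → E d}
    (hb : ContDiff ℝ 1 b) (hbD : tsupport b ⊆ D) :
    ∃ f f' : E d → Path T (E d), ContDiff ℝ 1 f ∧ ContDiff ℝ 1 f' ∧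
      (∀ x, HasTimeDeriv hT (f x) (f' x)) ∧ Function.support f ⊆ tsupport b ∧
      (∀ x ∈ D, ∀ t ∈ Icc 0 T, fderiv ℝ (Φ t) x (Path.extend hT (f x) t) =
        (ContinuousLinearMap.adjoint (fderiv ℝ (Φ t) x)).inverse (b x)) ∧
      ∀ x ∈ D, ∀ t ∈ Ioo 0 T, fderiv ℝ (Φ t) x (Path.extend hT (f' x) t) +
        lambdaMat Φ t x ((ContinuousLinearMap.adjoint (fderiv ℝ (Φ t) x)).inverse (b x)) = 0 := by
  let M : E d → Path T (E d →L[ℝ] E d) := fun x => Ring.inverse (metricPath T γ x)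
  let M' : E d → Path T (E d →L[ℝ] E d) := fun x => -(M x * metricDerivPath T γ z x * M x)
  have hM : ContDiffOn ℝ 1 M D := h.contDiffOn_ringInverse_metricPath hD
  have hM' : ContDiffOn ℝ 1 M' D := (Path.contDiffOn_mul
    (Path.contDiffOn_mul hM (h.contDiffOn_metricDerivPath hD)) hM).neg
  have hMM' : ∀ x ∈ D, HasTimeDeriv hT (M x) (M' x) := fun x hx =>
    (h.hasTimeDeriv_metricPath hD hx).ringInverse (h.isUnit_metricPath hx)
  -- `N` is controlled only on `D`, but `b` is supported there, so the product is `C¹` on the whole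
  -- space.
  let ap : (E d → Path T (E d →L[ℝ] E d)) → E d → Path T (E d) := fun N x =>
    applyCLM _ _ _ (N x) (constPath T (E d) (b x))
  have hap0 : ∀ N x, x ∉ tsupport b → ap N x = 0 := by
    intro N x hx
    simp only [ap, image_eq_zero_of_notMem_tsupport hx, map_zero]
  have hap : ∀ N, ContDiffOn ℝ 1 N D → ContDiff ℝ 1 (ap N) := by
    intro N hN
    rw [contDiff_iff_contDiffAt]
    intro x
    by_cases hx : x ∈ tsupport b
    · have h1 := (hN x (hbD hx)).contDiffAt (hD.mem_nhds (hbD hx))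
      have h2 : ContDiffAt ℝ 1 (fun x => constPath T (E d) (b x)) x :=
        (constPath T (E d)).contDiff.contDiffAt.comp x hb.contDiffAt
      exact ((applyCLM (Icc (0 : ℝ) T) (E d) (E d)).contDiff.contDiffAt.comp x h1).clm_apply h2
    · refine (contDiffAt_const (c := (0 : Path T (E d)))).congr_of_eventuallyEq ?_
      filter_upwards [(isClosed_tsupport b).isOpen_compl.mem_nhds hx] with y hy
      exact hap0 N y hy
  have hext : ∀ N x t, Path.extend hT (ap N x) t = Path.extend hT (N x) t (b x) :=
    fun N x t => rfl
  -- Pointwise `M = DΦ_t⁻¹ DΦ_t⁻ᵀ`, so multiplying by `DΦ_t` leaves `DΦ_t⁻ᵀ`.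
  have hMt : ∀ x ∈ D, ∀ t ∈ Icc 0 T, Path.extend hT (M x) t =
      Ring.inverse (fderiv ℝ (Φ t) x) * Ring.inverse (star (fderiv ℝ (Φ t) x)) := by
    intro x hx t ht
    have h1 : Path.extend hT (M x) t =
        Ring.inverse (star (fderiv ℝ (Φ t) x) * fderiv ℝ (Φ t) x) := by
      rw [h.fderiv_eq hD hx ht]
      exact Path.ringInverse_apply (h.isUnit_metricPath hx) _
    obtain ⟨v, hv⟩ := h.isUnit_fderiv hD hx ht
    rw [h1, ← hv, ← Units.coe_star, ← Units.val_mul, Ring.inverse_unit, Ring.inverse_unit,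
      Ring.inverse_unit, mul_inv_rev, Units.val_mul]
  refine ⟨ap M, ap M', hap M hM, hap M' hM', fun x => ?_, fun x hx => ?_, ?_, ?_⟩
  · by_cases hx : x ∈ tsupport b
    · intro t ht
      simp only [funext (hext M x), hext]
      exact (ContinuousLinearMap.apply ℝ (E d) (b x)).hasFDerivAt.comp_hasDerivAt t
        (hMM' x (hbD hx) t ht)
    · rw [hap0 _ x hx, hap0 _ x hx]
      exact fun t _ => hasDerivAt_const t 0
  · by_contra hx'
    exact hx (hap0 M x hx')
  · intro x hx t ht
    obtain ⟨v, hv⟩ := h.isUnit_fderiv hD hx ht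
    rw [hext, hMt x hx t ht, ← ContinuousLinearMap.ringInverse_eq_inverse,
      ← ContinuousLinearMap.star_eq_adjoint, ← mul_apply_eq_comp, ← mul_assoc,
      Ring.mul_inverse_cancel _ (h.isUnit_fderiv hD hx ht), one_mul]
  · intro x hx t ht
    have ht' := Ioo_subset_Icc_self ht
    have e : Path.extend hT (M' x) t = -(Path.extend hT (M x) t *
      Path.extend hT (metricDerivPath T γ z x) t * Path.extend hT (M x) t) := rfl
    rw [hext, e, hMt x hx t ht', lambdaMat, h.deriv_adjoint_comp hD hx ht,
      ← ContinuousLinearMap.ringInverse_eq_inverse, ← ContinuousLinearMap.star_eq_adjoint]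
    have hu := Ring.mul_inverse_cancel _ (h.isUnit_fderiv hD hx ht')
    set Y := fderiv ℝ (Φ t) x
    set Z := Path.extend hT (metricDerivPath T γ z x) t
    have key := mul_neg_add_mul_eq_zero hu (Ring.inverse (star Y)) Z
    exact congrArg (fun L : E d →L[ℝ] E d => L (b x)) key

end IsPathFlow

end Flow

end MovingStokes

namespace MovingStokes

open Filter

/-! ### Extension by zero. -/

section Extension

theorem support_indicator_subset_of_eqOn {X F : Type*} [Zero F] {W K : Set X} {h : X → F}
     (h0 : ∀ x ∈ W, x ∉ K → h x = 0) :
    Function.support (W.indicator h) ⊆ K := by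
  intro x hx
  by_contra hK
  refine hx ?_
  by_cases hW : x ∈ W
  · rw [indicator_of_mem hW, h0 x hW hK]
  · exact indicator_of_notMem hW h

variable {X F : Type*} [NormedAddCommGroup X] [NormedSpace ℝ X] [NormedAddCommGroup F]
  [NormedSpace ℝ F]

theorem contDiff_indicator {W K : Set X} (hW : IsOpen W) (hK : IsCompact K) (hKW : K ⊆ W)
    {n : ℕ∞ω} {h : X → F} (hh : ContDiffOn ℝ n h W) (h0 : ∀ x ∈ W, x ∉ K → h x = 0) :
    ContDiff ℝ n (W.indicator h) := by
  rw [contDiff_iff_contDiffAt]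
  intro x
  by_cases hx : x ∈ K
  · refine (hh.contDiffAt (hW.mem_nhds (hKW hx))).congr_of_eventuallyEq ?_
    filter_upwards [hW.mem_nhds (hKW hx)] with y hy using indicator_of_mem hy h
  · refine (contDiffAt_const (c := (0 : F))).congr_of_eventuallyEq ?_
    filter_upwards [hK.isClosed.isOpen_compl.mem_nhds hx] with y hy
    by_contra hy'
    exact hy (support_indicator_subset_of_eqOn h0 hy')

end Extension

/-! ### Transport of test functions and null sets by diffeomorphisms. -/

section Diffeo

variable {d : ℕ} {φ : E d → E d} {Ω : Set (E d)}

variable (φ Ω) in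
/-- `φ` is a `C²` diffeomorphism from the open set `Ω` onto its image. -/
structure IsDiffeoOn : Prop where
  isOpen : IsOpen Ω
  contDiffOn : ContDiffOn ℝ 2 φ Ω
  injOn : InjOn φ Ω
  isUnit : ∀ x ∈ Ω, IsUnit (fderiv ℝ φ x)

namespace IsDiffeoOn

variable (h : IsDiffeoOn φ Ω)
include h

theorem contDiffAt {x : E d} (hx : x ∈ Ω) : ContDiffAt ℝ 2 φ x :=
  h.contDiffOn.contDiffAt (h.isOpen.mem_nhds hx)

theorem invFunOn_apply {x : E d} (hx : x ∈ Ω) : Function.invFunOn φ Ω (φ x) = x :=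
  h.injOn.leftInvOn_invFunOn hx

theorem exists_equiv {x : E d} (hx : x ∈ Ω) :
    ∃ e : E d ≃L[ℝ] E d, HasStrictFDerivAt φ (e : E d →L[ℝ] E d) x := by
  obtain ⟨u, hu⟩ := h.isUnit x hx
  refine ⟨ContinuousLinearEquiv.unitsEquiv ℝ (E d) u, ?_⟩
  have e : (ContinuousLinearEquiv.unitsEquiv ℝ (E d) u : E d →L[ℝ] E d) = fderiv ℝ φ x := hu
  rw [e]
  exact (h.contDiffAt hx).hasStrictFDerivAt two_ne_zero

theorem isOpen_image : IsOpen (φ '' Ω) := by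
  rw [isOpen_iff_mem_nhds]
  rintro _ ⟨x, hx, rfl⟩
  obtain ⟨e, he⟩ := h.exists_equiv hx
  rw [← he.map_nhds_eq_of_equiv]
  exact image_mem_map (h.isOpen.mem_nhds hx)

/-- Injectivity makes the global inverse a left inverse near `x`, so it coincides near `φ x` with
the local inverse, which is `C²`. -/
theorem contDiffAt_invFunOn {x : E d} (hx : x ∈ Ω) :
    ContDiffAt ℝ 2 (Function.invFunOn φ Ω) (φ x) := by
  obtain ⟨e, he⟩ := h.exists_equiv hx
  refine ((h.contDiffAt hx).to_localInverse he.hasFDerivAt two_ne_zero).congr_of_eventuallyEq ?_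
  refine HasStrictFDerivAt.localInverse_unique _ ?_
  filter_upwards [h.isOpen.mem_nhds hx] with y hy using h.invFunOn_apply hy

theorem contDiffOn_invFunOn : ContDiffOn ℝ 2 (Function.invFunOn φ Ω) (φ '' Ω) := by
  rintro _ ⟨x, hx, rfl⟩
  exact (h.contDiffAt_invFunOn hx).contDiffWithinAt

theorem hasFDerivAt {x : E d} (hx : x ∈ Ω) : HasFDerivAt φ (fderiv ℝ φ x) x :=
  ((h.contDiffAt hx).differentiableAt two_ne_zero).hasFDerivAt

theorem hasFDerivAt_invFunOn {x : E d} (hx : x ∈ Ω) :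
    HasFDerivAt (Function.invFunOn φ Ω) (fderiv ℝ φ x).inverse (φ x) := by
  have h1 := ((h.contDiffAt_invFunOn hx).differentiableAt two_ne_zero).hasFDerivAt
  have h2 := h1.comp x (h.hasFDerivAt hx)
  have h3 : HasFDerivAt (Function.invFunOn φ Ω ∘ φ) (1 : E d →L[ℝ] E d) x := by
    refine (hasFDerivAt_id x).congr_of_eventuallyEq ?_
    filter_upwards [h.isOpen.mem_nhds hx] with y hy using h.invFunOn_apply hy
  have h4 : fderiv ℝ (Function.invFunOn φ Ω) (φ x) * fderiv ℝ φ x = 1 := h2.unique h3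
  rw [← ContinuousLinearMap.ringInverse_eq_inverse]
  rwa [(Ring.eq_mul_inverse_iff_mul_eq _ _ _ (h.isUnit x hx)).mpr h4, one_mul] at h1

/-- The gradient of a pushforward. -/
theorem gradient_comp_invFunOn {q : E d → ℝ} {x : E d} (hx : x ∈ Ω) (hq : DifferentiableAt ℝ q x) :
    gradient (q ∘ Function.invFunOn φ Ω) (φ x) =
      (ContinuousLinearMap.adjoint (fderiv ℝ φ x)).inverse (gradient q x) := by
  have h0 : HasGradientAt q (gradient q x) (Function.invFunOn φ Ω (φ x)) := by
    rw [h.invFunOn_apply hx]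
    exact hq.hasGradientAt
  have h1 := h0.hasFDerivAt.comp (φ x) (h.hasFDerivAt_invFunOn hx)
  refine HasGradientAt.gradient (hasGradientAt_iff_hasFDerivAt.mpr ?_)
  refine h1.congr_fderiv (ContinuousLinearMap.ext fun v => ?_)
  rw [← ContinuousLinearMap.ringInverse_eq_inverse, ← ContinuousLinearMap.star_eq_adjoint]
  obtain ⟨u, hu⟩ := h.isUnit x hx
  rw [← hu, ← Units.coe_star, Ring.inverse_unit, Ring.inverse_unit, ← star_inv, Units.coe_star,
    ContinuousLinearMap.star_eq_adjoint]
  exact (ContinuousLinearMap.adjoint_inner_left (↑u⁻¹ : E d →L[ℝ] E d) v (gradient q x)).symm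

/-- The gradient of a pullback. -/
theorem gradient_comp {q : E d → ℝ} {x : E d} (hx : x ∈ Ω) (hq : DifferentiableAt ℝ q (φ x)) :
    gradient (q ∘ φ) x = ContinuousLinearMap.adjoint (fderiv ℝ φ x) (gradient q (φ x)) := by
  have h1 := hq.hasGradientAt.hasFDerivAt.comp x (h.hasFDerivAt hx)
  refine HasGradientAt.gradient (hasGradientAt_iff_hasFDerivAt.mpr ?_)
  refine h1.congr_fderiv (ContinuousLinearMap.ext fun v => ?_)
  exact (ContinuousLinearMap.adjoint_inner_left (fderiv ℝ φ x) v (gradient q (φ x))).symm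

/-- The pushforward of a test function is a test function. -/
theorem exists_pushforward {q : E d → ℝ} (hq : ContDiff ℝ 2 q) (hqc : HasCompactSupport q)
    (hqΩ : tsupport q ⊆ Ω) : ∃ p : E d → ℝ, ContDiff ℝ 2 p ∧ HasCompactSupport p ∧
      tsupport p ⊆ φ '' Ω ∧ ∀ x ∈ Ω, gradient p (φ x) =
        (ContinuousLinearMap.adjoint (fderiv ℝ φ x)).inverse (gradient q x) := by
  have hK : IsCompact (φ '' tsupport q) :=
    hqc.isCompact.image_of_continuousOn (h.contDiffOn.continuousOn.mono hqΩ)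
  have h0 : ∀ y ∈ φ '' Ω, y ∉ φ '' tsupport q → (q ∘ Function.invFunOn φ Ω) y = 0 := by
    rintro _ ⟨x, hx, rfl⟩ hy
    rw [Function.comp_apply, h.invFunOn_apply hx]
    exact image_eq_zero_of_notMem_tsupport fun hx' => hy ⟨x, hx', rfl⟩
  have hs := support_indicator_subset_of_eqOn h0
  refine ⟨_, contDiff_indicator h.isOpen_image hK (image_mono hqΩ)
    (hq.comp_contDiffOn h.contDiffOn_invFunOn) h0, .of_support_subset_isCompact hK hs,
    (closure_minimal hs hK.isClosed).trans (image_mono hqΩ), fun x hx => ?_⟩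
  rw [← h.gradient_comp_invFunOn hx (hq.differentiable two_ne_zero x)]
  refine Filter.EventuallyEq.gradient_eq ?_
  filter_upwards [h.isOpen_image.mem_nhds ⟨x, hx, rfl⟩] with y hy using indicator_of_mem hy _

/-- The pullback of a test function is a test function. -/
theorem exists_pullback {q : E d → ℝ} (hq : ContDiff ℝ 2 q) (hqc : HasCompactSupport q)
    (hqΩ : tsupport q ⊆ φ '' Ω) : ∃ p : E d → ℝ, ContDiff ℝ 2 p ∧ HasCompactSupport p ∧
      tsupport p ⊆ Ω ∧ ∀ x ∈ Ω, gradient p x =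
        ContinuousLinearMap.adjoint (fderiv ℝ φ x) (gradient q (φ x)) := by
  have hK : IsCompact (Function.invFunOn φ Ω '' tsupport q) :=
    hqc.isCompact.image_of_continuousOn (h.contDiffOn_invFunOn.continuousOn.mono hqΩ)
  have hKΩ : Function.invFunOn φ Ω '' tsupport q ⊆ Ω := by
    rintro _ ⟨y, hy, rfl⟩
    exact Function.invFunOn_mem (hqΩ hy)
  have h0 : ∀ x ∈ Ω, x ∉ Function.invFunOn φ Ω '' tsupport q → (q ∘ φ) x = 0 := fun x hx hy =>
    image_eq_zero_of_notMem_tsupport (f := q) fun hx' => hy ⟨φ x, hx', h.invFunOn_apply hx⟩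
  have hs := support_indicator_subset_of_eqOn h0
  refine ⟨_, contDiff_indicator h.isOpen hK hKΩ (hq.comp_contDiffOn h.contDiffOn) h0,
    .of_support_subset_isCompact hK hs, (closure_minimal hs hK.isClosed).trans hKΩ, fun x hx => ?_⟩
  rw [← h.gradient_comp hx (hq.differentiable two_ne_zero _)]
  refine Filter.EventuallyEq.gradient_eq ?_
  filter_upwards [h.isOpen.mem_nhds hx] with y hy using indicator_of_mem hy _

/-- Differentiable maps send null sets to null sets; here this is applied to the inverse, and in
`ae_image` to `φ` itself. No change of variables in integrals is needed to pass between `Ω₀` and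
`Ω(t)`. -/
theorem ae_comp {P : E d → Prop} (hP : ∀ᵐ y ∂(volume.restrict (φ '' Ω)), P y) :
    ∀ᵐ x ∂(volume.restrict Ω), P (φ x) := by
  rw [ae_restrict_iff' h.isOpen_image.measurableSet, ae_iff] at hP
  rw [ae_restrict_iff' h.isOpen.measurableSet, ae_iff]
  refine measure_mono_null ?_ (addHaar_image_eq_zero_of_differentiableOn_of_addHaar_eq_zero volume
    (f := Function.invFunOn φ Ω) ((h.contDiffOn_invFunOn.differentiableOn two_ne_zero).mono ?_) hP)
  · intro x hx
    simp only [mem_ofPred_eq, Classical.not_imp] at hx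
    refine ⟨φ x, ?_, h.invFunOn_apply hx.1⟩
    simp only [mem_ofPred_eq, Classical.not_imp]
    exact ⟨⟨x, hx.1, rfl⟩, hx.2⟩
  · intro y hy
    simp only [mem_ofPred_eq, Classical.not_imp] at hy
    exact hy.1

theorem ae_image {P : E d → Prop} (hP : ∀ᵐ x ∂(volume.restrict Ω), P (φ x)) :
    ∀ᵐ y ∂(volume.restrict (φ '' Ω)), P y := by
  rw [ae_restrict_iff' h.isOpen.measurableSet, ae_iff] at hP
  rw [ae_restrict_iff' h.isOpen_image.measurableSet, ae_iff]
  refine measure_mono_null ?_ (addHaar_image_eq_zero_of_differentiableOn_of_addHaar_eq_zero volume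
    (f := φ) ((h.contDiffOn.differentiableOn two_ne_zero).mono ?_) hP)
  · intro y hy
    simp only [mem_ofPred_eq, Classical.not_imp] at hy
    obtain ⟨⟨x, hx, rfl⟩, h2⟩ := hy
    refine ⟨x, ?_, rfl⟩
    simp only [mem_ofPred_eq, Classical.not_imp]
    exact ⟨hx, h2⟩
  · intro y hy
    simp only [mem_ofPred_eq, Classical.not_imp] at hy
    exact hy.1

end IsDiffeoOn

theorem IsPathFlow.isDiffeoOn {D Ω₀ : Set (E d)} {T : ℝ} {hT : 0 ≤ T} {Φ : ℝ → E d → E d}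
    {γ z : E d → Path T (E d)} (h : IsPathFlow D hT Φ γ z) (hD : IsOpen D) (hΩ : IsOpen Ω₀)
    (hΩD : Ω₀ ⊆ D) {t : ℝ} (ht : t ∈ Icc 0 T) : IsDiffeoOn (Φ t) Ω₀ :=
  ⟨hΩ, (h.contDiffOn_flow ht).mono hΩD, (h.injOn t ht).mono hΩD,
    fun _ hx => h.isUnit_fderiv hD (hΩD hx) ht⟩

end Diffeo

end MovingStokes

namespace MovingStokes

open Filter

/-! ### Gradients as elements of `H^1_0`, and auxiliary facts. -/

section Gradients

variable {d : ℕ} {Ω : Set (E d)}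

theorem contDiff_gradient {q : E d → ℝ} (hq : ContDiff ℝ 2 q) : ContDiff ℝ 1 (gradient q) :=
  (InnerProductSpace.toDual ℝ (E d)).symm.contDiff.comp
    (hq.fderiv_right one_add_one_eq_two.le)

theorem support_gradient_subset (q : E d → ℝ) : Function.support (gradient q) ⊆ tsupport q := by
  intro x hx
  refine support_fderiv_subset ℝ fun h => hx ?_
  simp [gradient, h]

theorem tsupport_gradient_subset (q : E d → ℝ) : tsupport (gradient q) ⊆ tsupport q :=
  closure_minimal (support_gradient_subset q) (isClosed_tsupport q)

/-- Gradients of `C²` functions with compact support in `Ω` belong to `H^1_0(Ω)`. -/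
theorem exists_H10_gradient (hΩ : IsOpen Ω) {q : E d → ℝ} (hq : ContDiff ℝ 2 q)
    (hqc : HasCompactSupport q) (hqΩ : tsupport q ⊆ Ω) :
    ∃ p : H10 Ω, H10.fn p =ᵐ[volume.restrict Ω] gradient q :=
  exists_H10_of_contDiff hΩ (contDiff_gradient hq)
    (.of_support_subset_isCompact hqc (support_gradient_subset q))
    ((tsupport_gradient_subset q).trans hqΩ)

theorem H10.coeFn_smul (c : ℝ) (v : H10 Ω) :
    H10.fn (c • v) =ᵐ[volume.restrict Ω] fun x => c • H10.fn v x :=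
  Lp.coeFn_smul c (H10.fn v)

theorem isUnit_adjoint {L : E d →L[ℝ] E d} (hL : IsUnit L) :
    IsUnit (ContinuousLinearMap.adjoint L) := hL.star

theorem apply_inverse_apply {L : E d →L[ℝ] E d} (hL : IsUnit L) (v : E d) :
    L (L.inverse v) = v := by
  have h := Ring.mul_inverse_cancel L hL
  rw [ContinuousLinearMap.ringInverse_eq_inverse] at h
  exact congrArg (fun A : E d →L[ℝ] E d => A v) h

theorem inverse_apply_apply {L : E d →L[ℝ] E d} (hL : IsUnit L) (v : E d) :
    L.inverse (L v) = v := by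
  have h := Ring.inverse_mul_cancel L hL
  rw [ContinuousLinearMap.ringInverse_eq_inverse] at h
  exact congrArg (fun A : E d →L[ℝ] E d => A v) h

/-- If `g` is not integrable, neither is `f - g`, and both integrals take the default value zero.
This avoids proving that the integrand of `λ` is integrable. -/
theorem integral_sub_of_integral_eq_zero {α : Type*} [MeasurableSpace α] {μ : Measure α}
    {f g : α → ℝ} (hf : Integrable f μ) (h0 : ∫ x, f x ∂μ = 0) :
    ∫ x, (f x - g x) ∂μ = -∫ x, g x ∂μ := by
  by_cases hg : Integrable g μ
  · rw [integral_sub hf hg, h0, zero_sub]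
  · rw [integral_undef hg, integral_undef, neg_zero]
    intro h
    refine hg ((hf.sub h).congr (.of_forall fun x => ?_))
    simp

theorem two_le_infty : (2 : ℕ∞ω) ≤ ∞ := WithTop.coe_le_coe.mpr (le_top (a := (2 : ℕ∞)))

end Gradients

/-! ### Families of functionals and separability. -/

section Dual

variable {α X : Type*} [MeasurableSpace α] {μ : Measure α} [NormedAddCommGroup X] [NormedSpace ℝ X]
  {f : α → StrongDual ℝ X}

theorem integrable_apply_of_memLp [IsFiniteMeasure μ] (hf : MemLp f 2 μ) (p : X) :
    Integrable (fun t => f t p) μ :=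
  (hf.integrable one_le_two).apply_continuousLinearMap p

/-- Collect the null sets over a countable dense subset of `S`; continuity of each functional `f t`
extends the vanishing to all of `S`. -/
theorem ae_forall_mem_apply_eq_zero [TopologicalSpace.SeparableSpace X] {S : Set X}
    (hS : ∀ p ∈ S, ∀ᵐ t ∂μ, f t p = 0) : ∀ᵐ t ∂μ, ∀ p ∈ S, f t p = 0 := by
  obtain ⟨S', hS'S, hS'c, hSS'⟩ :=
    (TopologicalSpace.IsSeparable.of_separableSpace S).exists_countable_dense_subset
  filter_upwards [(ae_ball_iff hS'c).mpr fun p hp => hS p (hS'S hp)] with t ht p hp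
  exact closure_minimal (t := {p | f t p = 0}) ht (isClosed_eq (f t).continuous continuous_const)
    (hSS' hp)

end Dual

theorem secondCountableTopology_L2 {d : ℕ} {F : Type*} [NormedAddCommGroup F]
    [SecondCountableTopology F] (Ω : Set (E d)) :
    SecondCountableTopology (Lp F 2 (volume.restrict Ω)) := by
  have : Fact ((2 : ENNReal) ≠ ⊤) := ⟨ENNReal.ofNat_ne_top⟩
  infer_instance

instance {d : ℕ} {Ω : Set (E d)} : TopologicalSpace.SeparableSpace (H10 Ω) := by
  have := secondCountableTopology_L2 (F := E d) Ω
  have := secondCountableTopology_L2 (F := Mat d) Ω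
  have : SecondCountableTopology (L2Pair Ω) := WithLp.secondCountableTopology 2 _ _
  have : SecondCountableTopology (H10 Ω) := TopologicalSpace.Subtype.secondCountableTopology _
  exact TopologicalSpace.SecondCountableTopology.to_separableSpace

/-! ### Pulling back weakly divergence free functionals. -/

section Pullback

variable {d : ℕ} {Ω₀ : Set (E d)} {Φ : ℝ → E d → E d} {t : ℝ}

/-- A functional whose pullback is weakly divergence free is weakly divergence free. -/
theorem IsDualPullback.mem_Vstar (h : IsDiffeoOn (Φ t) Ω₀) {f : Hneg1 (movingDomain Φ Ω₀ t)}
    {f₀ : Hneg1 Ω₀} (hf : IsDualPullback f f₀) (hf₀ : f₀ ∈ Vstar Ω₀) :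
    f ∈ Vstar (movingDomain Φ Ω₀ t) := by
  have hΩ : IsOpen (movingDomain Φ Ω₀ t) := h.isOpen_image
  refine mem_Vstar_of_forall_smooth hΩ fun q p hq hqc hqΩ hp => ?_
  -- With `r = q ∘ Φ_t`, the chain rule gives `∇r = DΦ_tᵀ (∇q ∘ Φ_t)`, the covariant Piola transform
  -- of `∇q`. The function `r` is only `C²`, which `Vstar` allows.
  obtain ⟨r, hr, hrc, hrΩ, hrq⟩ := h.exists_pullback (hq.of_le two_le_infty) hqc hqΩ
  obtain ⟨v₀, hv₀⟩ := exists_H10_gradient h.isOpen hr hrc hrΩ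
  rw [← hf v₀ p]
  · exact hf₀ v₀ ⟨r, hr.of_le one_le_two, hrc, hrΩ, hv₀⟩
  · filter_upwards [hv₀, h.ae_comp hp, ae_restrict_mem h.isOpen.measurableSet] with x h1 h2 h3
    rw [h1, hrq x h3, piolaStar, h2]

end Pullback

/-! ### The test field and the vanishing of the functional. -/

section Test

variable {d : ℕ} {D Ω₀ : Set (E d)} {T : ℝ} {hT : 0 ≤ T} {Φ : ℝ → E d → E d}
  {γ z : E d → Path T (E d)}

/-- If `u(t)` is divergence free, then the weak material derivative of `u`, pulled back to `Ω₀`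
and tested with a gradient, vanishes in the sense of distributions. -/
theorem IsPathFlow.integral_smul_eq_zero (h : IsPathFlow D hT Φ γ z) (hD : IsOpen D)
    (hDb : Bornology.IsBounded D) (hΩ : IsOpen Ω₀) (hΩD : Ω₀ ⊆ D)
    {u : (t : ℝ) → H10 (movingDomain Φ Ω₀ t)} (hu : MemL2V T u)
    {g : (t : ℝ) → Hneg1 (movingDomain Φ Ω₀ t)} (hg : IsWeakMaterialDeriv T u g)
    {g₀ : ℝ → Hneg1 Ω₀} (hg₀ : ∀ᵐ t ∂(volume.restrict (Ioo 0 T)), IsDualPullback (g t) (g₀ t))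
    {q : E d → ℝ} (hq : ContDiff ℝ 2 q) (hqc : HasCompactSupport q) (hqΩ : tsupport q ⊆ Ω₀)
    {p : H10 Ω₀} (hp : H10.fn p =ᵐ[volume.restrict Ω₀] gradient q)
    {ψ : ℝ → ℝ} (hψ : ContDiff ℝ ∞ ψ) (hψc : HasCompactSupport ψ) (hψT : tsupport ψ ⊆ Ioo 0 T) :
    ∫ t in Ioo 0 T, ψ t • g₀ t p = 0 := by
  have hdiff : ∀ t ∈ Ioo 0 T, IsDiffeoOn (Φ t) Ω₀ := fun t ht =>
    h.isDiffeoOn hD hΩ hΩD (Ioo_subset_Icc_self ht)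
  have : IsFiniteMeasure (volume.restrict Ω₀) :=
    isFiniteMeasure_restrict.mpr (hDb.subset hΩD).measure_lt_top.ne
  obtain ⟨f, f', hf, hf', hff', hfs, hfq, hfl⟩ := h.exists_pullback_gradient hD
    (contDiff_gradient hq) (((tsupport_gradient_subset q).trans hqΩ).trans hΩD)
  obtain ⟨η₀, hη₀, hη₀f, hη₀d, hη₀ψ⟩ := exists_H10_curve_of_path hT hΩ hf hf' hff'
    hqc hqΩ (hfs.trans (tsupport_gradient_subset q)) hψ hψc hψT
  -- On `(0,T)`, `r t` is `q ∘ Φ_t⁻¹` extended by zero and `P t` is its gradient; at other times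
  -- arbitrary values are used.
  have hr : ∀ t, ∃ (P : H10 (movingDomain Φ Ω₀ t)) (r : E d → ℝ), t ∈ Ioo 0 T →
      ContDiff ℝ 2 r ∧ HasCompactSupport r ∧
      H10.fn P =ᵐ[volume.restrict (movingDomain Φ Ω₀ t)] gradient r ∧
      ∀ x ∈ Ω₀, gradient r (Φ t x) =
        (ContinuousLinearMap.adjoint (fderiv ℝ (Φ t) x)).inverse (gradient q x) := by
    intro t
    by_cases ht : t ∈ Ioo 0 T
    · obtain ⟨r, hr, hrc, hrΩ, hrq⟩ := (hdiff t ht).exists_pushforward hq hqc hqΩ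
      obtain ⟨P, hP⟩ := exists_H10_gradient (hdiff t ht).isOpen_image hr hrc hrΩ
      exact ⟨P, r, fun _ => ⟨hr, hrc, hP, hrq⟩⟩
    · exact ⟨0, 0, fun h' => absurd h' ht⟩
  choose P r hPr using hr
  let η : (t : ℝ) → H10 (movingDomain Φ Ω₀ t) := fun t => ψ t • P t
  have hη : ∀ t ∈ Ioo 0 T,
      H10.fn (η t) =ᵐ[volume.restrict (movingDomain Φ Ω₀ t)] fun y => ψ t • gradient (r t) y := by
    intro t ht
    filter_upwards [H10.coeFn_smul (ψ t) (P t), (hPr t ht).2.2.1] with y h1 h2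
    rw [h1, h2]
  have hηΦ : ∀ t ∈ Ioo 0 T, ∀ᵐ x ∂(volume.restrict Ω₀), H10.fn (η t) (Φ t x) =
      ψ t • (ContinuousLinearMap.adjoint (fderiv ℝ (Φ t) x)).inverse (gradient q x) := by
    intro t ht
    filter_upwards [(hdiff t ht).ae_comp (hη t ht), ae_restrict_mem hΩ.measurableSet] with x h1 h2
    rw [h1, (hPr t ht).2.2.2 x h2]
  have htest : IsTestFunction T η η₀ := by
    refine ⟨hη₀, hψc.of_isClosed_subset (isClosed_tsupport _) hη₀ψ, hη₀ψ.trans hψT, fun t ht => ?_⟩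
    filter_upwards [hη₀f t, hηΦ t ht, ae_restrict_mem hΩ.measurableSet] with x h1 h2 h3
    rw [h1, piolaInv, h2, ← hfq x (hΩD h3) t (Ioo_subset_Icc_self ht), map_smul,
      inverse_apply_apply ((hdiff t ht).isUnit x h3)]
  -- The covariant transform `φ_t^*` undoes the factor `DΦ_t⁻ᵀ`, so `η(t)` corresponds to `ψ(t) ∇q`
  -- on `Ω₀`.
  have hleft : ∫ t in Ioo 0 T, g t (η t) = ∫ t in Ioo 0 T, ψ t • g₀ t p := by
    refine integral_congr_ae ?_
    filter_upwards [hg₀, ae_restrict_mem measurableSet_Ioo] with t hgt ht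
    rw [← map_smul]
    refine (hgt _ _ ?_).symm
    filter_upwards [H10.coeFn_smul (ψ t) p, hp, hηΦ t ht, ae_restrict_mem hΩ.measurableSet]
      with x h1 h2 h3 h4
    rw [h1, h2, piolaStar, h3, map_smul,
      apply_inverse_apply (isUnit_adjoint ((hdiff t ht).isUnit x h4))]
  have hright : ∀ᵐ t ∂(volume.restrict (Ioo 0 T)),
      ∫ y in movingDomain Φ Ω₀ t, ⟪H10.fn (u t) y, strongMaterialDeriv Φ Ω₀ η₀ t y⟫_ℝ =
        -lambdaForm Φ Ω₀ t (H10.fn (u t)) (H10.fn (η t)) := by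
    filter_upwards [hu.1, ae_restrict_mem measurableSet_Ioo] with t hut ht
    obtain ⟨hr, hrc, hP, hrq⟩ := hPr t ht
    -- The product rule splits the strong derivative of `η`: the cutoff contributes a multiple of a
    -- gradient, and the inverse metric contributes minus the matrix of `λ` applied to `η`.
    have hsum : ∀ᵐ y ∂(volume.restrict (movingDomain Φ Ω₀ t)),
        strongMaterialDeriv Φ Ω₀ η₀ t y = deriv ψ t • gradient (r t) y -
          lambdaMat Φ t (flowInv Φ Ω₀ t y) (H10.fn (η t) y) := by
      refine (hdiff t ht).ae_image ?_
      filter_upwards [hη₀d t, hηΦ t ht, ae_restrict_mem hΩ.measurableSet] with x h1 h2 h3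
      have e : flowInv Φ Ω₀ t (Φ t x) = x := (hdiff t ht).invFunOn_apply h3
      rw [strongMaterialDeriv, piola, e, h1, h2, hrq x h3, map_add, map_smul, map_smul, map_smul,
        hfq x (hΩD h3) t (Ioo_subset_Icc_self ht), eq_neg_of_add_eq_zero_left (hfl x (hΩD h3) t ht),
        smul_neg, sub_eq_add_neg]
    have hint : Integrable (fun y => deriv ψ t * ⟪H10.fn (u t) y, gradient (r t) y⟫_ℝ)
        (volume.restrict (movingDomain Φ Ω₀ t)) := by
      refine Integrable.const_mul ((L2.integrable_inner (𝕜 := ℝ) (H10.fn (u t))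
        (H10.fn (P t))).congr ?_) _
      filter_upwards [hP] with y hy
      rw [hy]
    rw [lambdaForm, ← integral_sub_of_integral_eq_zero hint]
    · refine integral_congr_ae ?_
      filter_upwards [hsum] with y hy
      rw [hy, inner_sub_right, real_inner_smul_right]
    -- The gradient part vanishes because `u(t)` is divergence free.
    · rw [integral_const_mul, integral_inner_gradient_eq_zero hut (hr.of_le one_le_two) hrc,
        mul_zero]
  rw [← hleft, hg.2 η η₀ htest, integral_congr_ae hright, integral_neg, neg_neg, sub_self]

/-- The pullback to `Ω₀` of the weak material derivative is weakly divergence free. -/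
theorem IsPathFlow.ae_mem_Vstar (h : IsPathFlow D hT Φ γ z) (hD : IsOpen D)
    (hDb : Bornology.IsBounded D) (hΩ : IsOpen Ω₀) (hΩD : Ω₀ ⊆ D)
    {u : (t : ℝ) → H10 (movingDomain Φ Ω₀ t)} (hu : MemL2V T u)
    {g : (t : ℝ) → Hneg1 (movingDomain Φ Ω₀ t)} (hg : IsWeakMaterialDeriv T u g)
    {g₀ : ℝ → Hneg1 Ω₀} (hg₀ : MemLp g₀ 2 (volume.restrict (Ioo 0 T)))
    (hgg₀ : ∀ᵐ t ∂(volume.restrict (Ioo 0 T)), IsDualPullback (g t) (g₀ t)) :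
    ∀ᵐ t ∂(volume.restrict (Ioo 0 T)), g₀ t ∈ Vstar Ω₀ := by
  let S : Set (H10 Ω₀) := {p | ∃ q : E d → ℝ, ContDiff ℝ ∞ q ∧ HasCompactSupport q ∧
    tsupport q ⊆ Ω₀ ∧ H10.fn p =ᵐ[volume.restrict Ω₀] gradient q}
  have hS : ∀ p ∈ S, ∀ᵐ t ∂(volume.restrict (Ioo 0 T)), g₀ t p = 0 := by
    rintro p ⟨q, hq, hqc, hqΩ, hp⟩
    have hint : IntegrableOn (fun t => g₀ t p) (Ioo 0 T) := integrable_apply_of_memLp hg₀ p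
    rw [ae_restrict_iff' measurableSet_Ioo]
    -- Fundamental lemma of the calculus of variations in time, for fixed `q`.
    refine isOpen_Ioo.ae_eq_zero_of_integral_contDiff_smul_eq_zero hint.locallyIntegrableOn ?_
    intro ψ hψ hψc hψT
    rw [← h.integral_smul_eq_zero hD hDb hΩ hΩD hu hg hgg₀
      (hq.of_le two_le_infty) hqc hqΩ hp hψ hψc hψT]
    refine (setIntegral_eq_integral_of_forall_compl_eq_zero fun t ht => ?_).symm
    rw [image_eq_zero_of_notMem_tsupport fun h' => ht (hψT h'), zero_smul]
  filter_upwards [ae_forall_mem_apply_eq_zero hS] with t ht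
  exact mem_Vstar_of_forall_smooth hΩ fun q p hq hqc hqΩ hp => ht p ⟨q, hq, hqc, hqΩ, hp⟩

end Test

/-! ### Passage to functions with values in `V^*`, and the main theorem. -/

theorem memLp_submodule {α G : Type*} [MeasurableSpace α] {μ : Measure α}
    [SeminormedAddCommGroup G] [Module ℝ G] (W : Submodule ℝ G) {p : ENNReal} {f : α → G}
    (hf : MemLp f p μ) (f' : α → W) (h : ∀ᵐ x ∂μ, (f' x : G) = f x) : MemLp f' p μ := by
  constructor
  · refine (IsEmbedding.subtypeVal (p := (· ∈ W))).aestronglyMeasurable_comp_iff.mp ?_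
    exact hf.1.congr (h.mono fun x hx => hx.symm)
  · have h2 : ∀ᵐ x ∂μ, ‖f' x‖ₑ = ‖f x‖ₑ := by
      filter_upwards [h] with x hx
      rw [← hx]
      rfl
    rw [eLpNorm_congr_enorm_ae h2]
    exact hf.2

theorem exists_lift_of_ae_mem {α G : Type*} [MeasurableSpace α] {μ : Measure α} [AddCommMonoid G]
    [Module ℝ G] {W : Submodule ℝ G} {f : α → G} (hW : ∀ᵐ x ∂μ, f x ∈ W) :
    ∃ f' : α → W, ∀ᵐ x ∂μ, (f' x : G) = f x := by
  classical
  refine ⟨fun x => if hx : f x ∈ W then ⟨f x, hx⟩ else 0, ?_⟩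
  filter_upwards [hW] with x hx
  rw [dif_pos hx]

theorem memL2Vstar_of_ae_mem {d : ℕ} {Ω₀ : Set (E d)} {Φ : ℝ → E d → E d} {T : ℝ}
    {g : (t : ℝ) → Hneg1 (movingDomain Φ Ω₀ t)} {g₀ : ℝ → Hneg1 Ω₀}
    (hg₀ : MemLp g₀ 2 (volume.restrict (Ioo 0 T)))
    (hgg₀ : ∀ᵐ t ∂(volume.restrict (Ioo 0 T)), IsDualPullback (g t) (g₀ t))
    (hV : ∀ᵐ t ∂(volume.restrict (Ioo 0 T)), g₀ t ∈ Vstar Ω₀)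
    (hg : ∀ᵐ t ∂(volume.restrict (Ioo 0 T)), g t ∈ Vstar (movingDomain Φ Ω₀ t)) :
    MemL2Vstar T g := by
  obtain ⟨g₁, h⟩ := exists_lift_of_ae_mem hV
  refine ⟨hg, g₁, memLp_submodule (G := Hneg1 Ω₀) (Vstar Ω₀) hg₀ g₁ h, ?_⟩
  filter_upwards [hgg₀, h] with t h1 h2
  rwa [h2]

end MovingStokes

end

theorem mainTheorem7 {d : ℕ} (hd : d = 2 ∨ d = 3)
    (D : Set (MovingStokes.E d)) (hD : IsOpen D) (hDb : Bornology.IsBounded D)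
    (Ω₀ : Set (MovingStokes.E d)) (hΩ : IsOpen Ω₀) (hΩD : closure Ω₀ ⊆ D)
    (hΩ2 : MovingStokes.HasC2Boundary Ω₀)
    (T : ℝ) (hT : 0 < T)
    (w : ℝ → MovingStokes.E d → MovingStokes.E d) (hw : MovingStokes.IsVelocityField D T w)
    (Φ : ℝ → MovingStokes.E d → MovingStokes.E d) (hΦ : MovingStokes.IsFlow D T w Φ)
    (u : (t : ℝ) → MovingStokes.H10 (MovingStokes.movingDomain Φ Ω₀ t))
    (hu : MovingStokes.MemL2V T u)
    (g : (t : ℝ) → MovingStokes.Hneg1 (MovingStokes.movingDomain Φ Ω₀ t))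
    (hg : MovingStokes.IsWeakMaterialDeriv T u g) :
    MovingStokes.MemL2Vstar T g := by
  obtain ⟨γ, z, h⟩ := hΦ.exists_isPathFlow (hT := hT.le) hD hw
  have hΩ' := subset_closure.trans hΩD
  obtain ⟨g₀, hg₀, hgg₀⟩ := hg.1
  have hV := h.ae_mem_Vstar hD hDb hΩ hΩ' hu hg hg₀ hgg₀
  refine MovingStokes.memL2Vstar_of_ae_mem hg₀ hgg₀ hV ?_
  -- For almost every `t`, divergence freeness is carried from `g₀(t)` on `Ω₀` to `g(t)` on `Ω(t)`
  -- by the diffeomorphism `Φ_t`.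
  filter_upwards [hV, hgg₀, MeasureTheory.ae_restrict_mem measurableSet_Ioo] with t h1 h2 ht
  exact h2.mem_Vstar (h.isDiffeoOn hD hΩ hΩ' (Set.Ioo_subset_Icc_self ht)) h1
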